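/- **Setting.** Let $\mathbb{S}$ be a collection of rings and/or abelian groups, let $(\mathbb{P},\mathrm{ar},\mathrm{type},[\![\cdot]\!])$ be a collection of predicates $[\![P]\!]\subseteq S_1\times\dots\times S_m$ with $S_i\in\mathbb{S}$, and let $\mathbf{W}$ be a finite set of weight symbols, each with an arity $\ge 1$ and a type in $\mathbb{S}$. For a finite relational signature $\sigma$, a $(\sigma,\mathbf{W})$-structure $\mathcal{A}$ consists of a finite non-empty universe $A$, relations $R^{\mathcal{A}}\subseteq A^{\mathrm{ar}(R)}$ for $R\in\sigma$, and maps $w^{\mathcal{A}}:A^{\mathrm{ar}(w)}\to \mathrm{type}(w)$ for $w\in\mathbf{W}$ such that $w^{\mathcal{A}}(a_1,\dots,a_m)\neq 0$ implies that $m=1$, or $a_1=\dots=a_m$, or $a_1,\dots,a_m$ all occur in one tuple of some $R^{\mathcal{A}}$. Distinct elements are adjacent in the Gaifman graph of $\mathcal{A}$ if they occur together in a tuple of a relation; the degree of $\mathcal A$ is the maximum degree of this graph, and $N^{\mathcal{A}}_r(X)$ is the set of the elements at distance at most $r$ in it from some element of $X\subseteq A$. A logic over $\sigma$ and $\mathbf{W}$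 is given by formulas with finitely many free variables and an isomorphism-invariant satisfaction relation that depends only on the values of the free variables (first-order logic with weight aggregation and its fragments are examples). A formula is $r$-local if its truth in any $(\sigma,\mathbf{W})$-structure $\mathcal{A}$ at any values $\bar a$ of its free variables agrees with its truth at $\bar a$ in the substructure induced on $N_r^{\mathcal{A}}(\bar a)$ (no condition on formulas without free variables). A Feferman–Vaught decomposition of $\varphi$ in a set $\Psi$ of formulas with respect to a partition $(\bar z;\bar z')$ of its free variables is a finite non-empty set $\Delta$ of pairs $(\alpha(\bar z),\beta(\bar z'))$ of formulas of $\Psi$ such that, for all $(\sigma,\mathbf{W})$-structures $\mathcal{A},\mathcal{B}$ with disjoint universes and all tuples $\bar a$ of $\mathcal{A}$ and $\bar b$ of $\mathcal{B}$, the formula $\varphi$ holds at $(\bar a,\bar b)$ in the disjoint union of $\mathcal{A}$ and $\mathcal{B}$ if and only if $\mathcal{A}\models\alpha[\bar a]$ and $\mathcal{B}\models\beta[\bar b]$ for some $(\alpha,\beta)\in\Delta$. Fix $k,\ell\in\mathbb{N}$. For a set $\Phi$ of formulas $\varphi(\bar x,\bar y)$ with $|\bar x|=k$, $|\bar y|=\ell$,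 let $\mathcal{C}(\Phi,\mathcal{A},k,\ell)$ be the set of all maps $A^k\to\{0,1\}$ of the form $\bar a\mapsto [\![\varphi(\bar a,\bar v)]\!]^{\mathcal{A}}$ with $\varphi\in\Phi$ and $\bar v\in A^\ell$. **Assumption.** Let $\Phi$ be a set of formulas $\varphi(\bar x,\bar y)$ of a logic over $\sigma$ and $\mathbf{W}$. Let $r\in\mathbb{N}$, let $\sigma^*$ be a signature, and let $\Phi^*$ be a finite set of $r$-local formulas $\varphi^*(\bar x,\bar y)$ of a logic over $\sigma^*$ and $\mathbf{W}$ such that: 1. for every $(\sigma,\mathbf{W})$-structure $\mathcal{A}$ there is an *associated* structure, i.e. a $(\sigma^*,\mathbf{W})$-structure $\mathcal{A}^*$ with the same universe such that for every $\varphi\in\Phi$ there is a $\varphi^*\in\Phi^*$ with $\mathcal{A}\models\varphi[\bar a,\bar b]\iff\mathcal{A}^*\models\varphi^*[\bar a,\bar b]$ for all $\bar a\in A^k$, $\bar b\in A^\ell$; 2. every $\varphi^*\in\Phi^*$ has a Feferman–Vaught decomposition in $\Phi^*$ with respect to every partition of its free variables into two non-empty parts; 3. for all $\varphi_1^*,\varphi_2^*\in\Phi^*$,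 the set $\Phi^*$ contains formulas equivalent to $\neg\varphi_1^*$ and to $\varphi_1^*\vee\varphi_2^*$. **Algorithms.** Algorithms have only *local access* to $\mathcal{A}^*$: they access it only by the queries "Is $\bar a\in R^{\mathcal{A}^*}$?", "Return $w^{\mathcal{A}^*}(\bar a)$" and "Return a list of all neighbours of $a$ in the Gaifman graph of $\mathcal{A}^*$", asked about elements that occur in the input or in earlier answers. They are programs of a WHILE language over binary trees whose leaves are nil, elements and weights, with subroutine calls. Every operation (including arithmetic in the members of $\mathbb{S}$ and evaluation of predicates of $\mathbb{P}$) takes one time unit, and in addition every name of an element that is compared, passed to a query or returned by a query takes $\lfloor\log_2 |A|\rfloor+1$ time units. **Theorem (Exact Learning with Precomputation).** There are constants $C,c\in\mathbb{N}$, depending only on the data fixed above, such that for every family of programs $(\mathrm{mc}_{\varphi^*})_{\varphi^*\in\Phi^*}$ with local access there is a program $\mathfrak{L}$ with local access for which the following holds. Let $\mathcal{A}$ be a $(\sigma,\mathbf{W})$-structure and let $\mathcal{A}^*$ be a structure associated with $\mathcal{A}$, of size $n$ and degree $d$. Let $f_{\Phi^*}(\mathcal{A}^*)\geq 1$ be an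 upper bound on the time of model checking for the formulas in $\Phi^*$ on $\mathcal{A}^*$; that is, for all $\varphi^*\in\Phi^*$, $\bar a\in A^k$ and $\bar v\in A^\ell$, the program $\mathrm{mc}_{\varphi^*}$ on input $(\bar a,\bar v)$ with local access to $\mathcal{A}^*$ decides within time $f_{\Phi^*}(\mathcal{A}^*)$ whether $\mathcal{A}^*\models\varphi^*[\bar a,\bar v]$. Let $T=((\bar a_1,b_1),\dots,(\bar a_t,b_t))\in(A^k\times\{0,1\})^t$ be a training sequence, where $k,t\geq 1$ or $\ell=0$. Then, on input $T$ and with local access to $\mathcal{A}^*$, the program $\mathfrak{L}$ halts within time $$C\cdot f_{\Phi^*}(\mathcal{A}^*)\cdot(\log n+d+t+1)^{c},\qquad\text{i.e. } f_{\Phi^*}(\mathcal{A}^*)\cdot(\log n+d+t)^{O(1)},$$ where $\log n=\lfloor\log_2 n\rfloor$, and * either it returns a formula $\varphi^*\in\Phi^*$ and a tuple $\bar v^*\in A^\ell$, with all entries in the $(2r+1)\ell$-neighbourhood in $\mathcal{A}^*$ of the set of elements that occur in $\bar a_1,\dots,\bar a_t$, such that $[\![\varphi^*(\bar a_i,\bar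 v^*)]\!]^{\mathcal{A}^*}=b_i$ for all $i\in\{1,\dots,t\}$; * or it rejects, and no $h\in\mathcal{C}(\Phi,\mathcal{A},k,\ell)$ satisfies $h(\bar a_i)=b_i$ for all $i\in\{1,\dots,t\}$. -/

import Mathlib

universe u v

noncomputable section

/-- A collection of rings and/or abelian groups. -/
structure WeightColl where
  ι : Type
  carrier : ι → Type
  alg : ∀ i, AddCommGroup (carrier i) ⊕ Ring (carrier i)

instance WeightColl.instAddCommGroup (S : WeightColl) (i : S.ι) : AddCommGroup (S.carrier i) :=
  match S.alg i with
  | Sum.inl h => h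
  | Sum.inr h => h.toAddCommGroup

/-- The product of the ring `S i`; there is none if `S i` is only an abelian group. -/
def WeightColl.mul? (S : WeightColl) (i : S.ι) (a b : S.carrier i) : Option (S.carrier i) :=
  match S.alg i with
  | Sum.inl _ => none
  | Sum.inr h => some (h.mul a b)

/-- A predicate collection over `S`. -/
structure PredColl (S : WeightColl) where
  Name : Type
  countable : Countable Name
  ar : Name → ℕ
  ar_pos : ∀ p, 0 < ar p
  type : ∀ p, Fin (ar p) → S.ι
  sem : ∀ p, Set (∀ i : Fin (ar p), S.carrier (type p i))

/-- A (finite, relational) signature; arity `0` is allowed. -/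
structure Sig where
  Rel : Type
  finite : Finite Rel
  ar : Rel → ℕ

/-- A finite set of weight symbols. -/
structure WSig (S : WeightColl) where
  Sym : Type
  finite : Finite Sym
  ar : Sym → ℕ
  ar_pos : ∀ w, 0 < ar w
  type : Sym → S.ι

/-- The data of a structure with universe `V`: an interpretation of the relation symbols and of
the weight symbols. Together with `WStr.IsWeighted` (and `V` finite and nonempty) this is a
`(σ, W)`-structure. Induced substructures are formed on the level of the data. -/
structure WStr {S : WeightColl} (σ : Sig) (W : WSig S) (V : Type) where
  rel : ∀ R : σ.Rel, Set (Fin (σ.ar R) → V)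
  wt : ∀ w : W.Sym, (Fin (W.ar w) → V) → S.carrier (W.type w)

namespace WStr

variable {S : WeightColl} {σ : Sig} {W : WSig S} {V V' : Type}

/-- The locality condition on the weights of a `(σ, W)`-structure. -/
def IsWeighted (A : WStr σ W V) : Prop :=
  ∀ (w : W.Sym) (a : Fin (W.ar w) → V), A.wt w a ≠ 0 →
    W.ar w = 1 ∨ (∀ i j, a i = a j) ∨
      ∃ R : σ.Rel, ∃ b ∈ A.rel R, Set.range a ⊆ Set.range b

/-- The Gaifman graph. -/
def gaifman (A : WStr σ W V) : SimpleGraph V where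
  Adj a b := a ≠ b ∧ ∃ R : σ.Rel, ∃ t ∈ A.rel R, a ∈ Set.range t ∧ b ∈ Set.range t
  symm := ⟨fun _ _ ⟨h, R, t, ht, ha, hb⟩ => ⟨h.symm, R, t, ht, hb, ha⟩⟩
  loopless := ⟨fun _ h => h.1 rfl⟩

/-- The degree of a (finite) structure: the maximum degree of its Gaifman graph. -/
def degree (A : WStr σ W V) : ℕ := ⨆ v : V, (A.gaifman.neighborSet v).ncard

/-- All elements at distance at most `r` from some element of `X`. -/
def ball (A : WStr σ W V) (r : ℕ) (X : Set V) : Set V :=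
  {b | ∃ a ∈ X, A.gaifman.edist a b ≤ r}

/-- The induced substructure. -/
def induce (A : WStr σ W V) (B : Set V) : WStr σ W B where
  rel R := {t | (fun i => (t i : V)) ∈ A.rel R}
  wt w t := A.wt w (fun i => (t i : V))

open Classical in
/-- The disjoint union. -/
def dunion (A : WStr σ W V) (B : WStr σ W V') : WStr σ W (V ⊕ V') where
  rel R := {c | (∃ a ∈ A.rel R, c = Sum.inl ∘ a) ∨ (∃ b ∈ B.rel R, c = Sum.inr ∘ b)}
  wt w c :=
    if h : ∃ a, c = Sum.inl ∘ a then A.wt w h.choose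
    else if h : ∃ b, c = Sum.inr ∘ b then B.wt w h.choose
    else 0

/-- `e` is an isomorphism from `A` to `B`. -/
def IsIso (e : V ≃ V') (A : WStr σ W V) (B : WStr σ W V') : Prop :=
  (∀ R t, t ∈ A.rel R ↔ e ∘ t ∈ B.rel R) ∧ (∀ w t, A.wt w t = B.wt w (e ∘ t))

end WStr

/-- A logic over the signature `σ` and the weight symbols `W`: formulas with finitely many free
variables (the variables are the natural numbers) and a satisfaction relation on finite structures
with assignments that depends only on the values of the free variables and is invariant under
isomorphism. -/
structure WLogic {S : WeightColl} (σ : Sig) (W : WSig S) where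
  Formula : Type u
  free : Formula → Finset ℕ
  Sat : ∀ {V : Type} [Finite V], WStr σ W V → (ℕ → V) → Formula → Prop
  sat_congr : ∀ {V : Type} [Finite V] (A : WStr σ W V) (β β' : ℕ → V) (φ : Formula),
    (∀ x ∈ free φ, β x = β' x) → (Sat A β φ ↔ Sat A β' φ)
  sat_iso : ∀ {V V' : Type} [Finite V] [Finite V'] (e : V ≃ V') (A : WStr σ W V)
    (B : WStr σ W V') (β : ℕ → V) (φ : Formula),
    WStr.IsIso e A B → (Sat A β φ ↔ Sat B (e ∘ β) φ)

/-! ### First-order logic with weight aggregation is a logic in this sense -/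

section WA

variable {S : WeightColl}

/-- `S i` is a ring and not just an abelian group. -/
def WeightColl.IsRing (S : WeightColl) (i : S.ι) : Prop := (S.alg i).isRight

/-- A factor of a weight product of type `i`. -/
inductive WFactor (W : WSig S) : S.ι → Type
  | const {i : S.ι} (s : S.carrier i) : WFactor W i
  | weight (w : W.Sym) (y : Fin (W.ar w) → ℕ) (hy : Function.Injective y) : WFactor W (W.type w)

/-- A weight product of type `i`: the product of the list `head :: tail`, of length one unless
`S i` is a ring. -/
structure WProduct (W : WSig S) (i : S.ι) where
  head : WFactor W i
  tail : List (WFactor W i)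
  group : ¬ S.IsRing i → tail = []

/-- Formulas (index `none`) and terms of type `i` (index `some i`). -/
inductive WAExpr (σ : Sig) (W : WSig S) (P : PredColl S) : Option S.ι → Type
  | eq (x y : ℕ) : WAExpr σ W P none
  | rel (R : σ.Rel) (x : Fin (σ.ar R) → ℕ) : WAExpr σ W P none
  | wtEq (w : W.Sym) (s : S.carrier (W.type w)) (x : Fin (W.ar w) → ℕ)
      (hx : Function.Injective x) : WAExpr σ W P none
  | neg (φ : WAExpr σ W P none) : WAExpr σ W P none
  | or (φ ψ : WAExpr σ W P none) : WAExpr σ W P none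
  | ex (y : ℕ) (φ : WAExpr σ W P none) : WAExpr σ W P none
  | sumEq (w : W.Sym) (s : S.carrier (W.type w)) (y : Fin (W.ar w) → ℕ)
      (hy : Function.Injective y) (φ : WAExpr σ W P none) : WAExpr σ W P none
  | pred (p : P.Name) (t : ∀ i : Fin (P.ar p), WAExpr σ W P (some (P.type p i))) :
      WAExpr σ W P none
  | const {i : S.ι} (s : S.carrier i) : WAExpr σ W P (some i)
  | weight (w : W.Sym) (x : Fin (W.ar w) → ℕ) (hx : Function.Injective x) :
      WAExpr σ W P (some (W.type w))
  | add {i : S.ι} (t t' : WAExpr σ W P (some i)) : WAExpr σ W P (some i)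
  | sub {i : S.ι} (t t' : WAExpr σ W P (some i)) : WAExpr σ W P (some i)
  | mul {i : S.ι} (h : S.IsRing i) (t t' : WAExpr σ W P (some i)) : WAExpr σ W P (some i)
  | sum {i : S.ι} (p : WProduct W i) (φ : WAExpr σ W P none) : WAExpr σ W P (some i)

variable {σ : Sig} {W : WSig S} {P : PredColl S} {V V' : Type}

def WFactor.vars : ∀ {i : S.ι}, WFactor W i → Finset ℕ
  | _, .const _ => ∅
  | _, .weight _ y _ => Finset.univ.image y

def WProduct.vars {i : S.ι} (p : WProduct W i) : Finset ℕ :=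
  (p.head :: p.tail).foldr (fun t Y => t.vars ∪ Y) ∅

def WFactor.eval (A : WStr σ W V) (β : ℕ → V) : ∀ {i : S.ι}, WFactor W i → S.carrier i
  | _, .const s => s
  | _, .weight w y _ => A.wt w (β ∘ y)

/-- Multiplication, with value `0` where there is none. -/
def WeightColl.mul (S : WeightColl) (i : S.ι) (a b : S.carrier i) : S.carrier i :=
  (S.mul? i a b).getD 0

def WProduct.eval (A : WStr σ W V) (β : ℕ → V) {i : S.ι} (p : WProduct W i) : S.carrier i :=
  p.tail.foldl (fun s t => S.mul i s (t.eval A β)) (p.head.eval A β)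

namespace WAExpr

def free : ∀ {o : Option S.ι}, WAExpr σ W P o → Finset ℕ
  | _, eq x y => {x, y}
  | _, rel _ x => Finset.univ.image x
  | _, wtEq _ _ x _ => Finset.univ.image x
  | _, neg φ => φ.free
  | _, or φ ψ => φ.free ∪ ψ.free
  | _, ex y φ => φ.free \ {y}
  | _, sumEq _ _ y _ φ => φ.free \ Finset.univ.image y
  | _, pred _ t => Finset.univ.biUnion fun i => (t i).free
  | _, const _ => ∅
  | _, weight _ x _ => Finset.univ.image x
  | _, add t t' => t.free ∪ t'.free
  | _, sub t t' => t.free ∪ t'.free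
  | _, mul _ t t' => t.free ∪ t'.free
  | _, sum p φ => φ.free \ p.vars

/-- Truth values for formulas, elements of `S i` for terms of type `i`. -/
abbrev Den (S : WeightColl) : Option S.ι → Type
  | none => Prop
  | some i => S.carrier i

open Classical in
/-- The semantics. `Function.extend y a β` is the assignment `β` with the variables `y` reset to
the values `a`. -/
def eval (A : WStr σ W V) : ∀ {o : Option S.ι}, WAExpr σ W P o → (ℕ → V) → Den S o
  | _, eq x y, β => (β x = β y : Prop)
  | _, rel R x, β => (β ∘ x ∈ A.rel R : Prop)
  | _, wtEq w s x _, β => (s = A.wt w (β ∘ x) : Prop)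
  | _, neg φ, β => (¬ (φ.eval A β : Prop) : Prop)
  | _, or φ ψ, β => ((φ.eval A β : Prop) ∨ (ψ.eval A β : Prop) : Prop)
  | _, ex y φ, β => (∃ a : V, (φ.eval A (Function.update β y a) : Prop) : Prop)
  | _, sumEq w s y _ φ, β =>
      (s = ∑ᶠ a : Fin (W.ar w) → V,
        if (φ.eval A (Function.extend y a β) : Prop) then A.wt w a else 0 : Prop)
  | _, pred p t, β => ((fun i => ((t i).eval A β : S.carrier _)) ∈ P.sem p : Prop)
  | _, const s, _ => s
  | _, weight w x _, β => A.wt w (β ∘ x)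
  | _, add (i := i) t t', β => ((t.eval A β : S.carrier i) + (t'.eval A β : S.carrier i) :)
  | _, sub (i := i) t t', β => ((t.eval A β : S.carrier i) - (t'.eval A β : S.carrier i) :)
  | _, mul (i := i) _ t t', β => S.mul i (t.eval A β) (t'.eval A β)
  | _, sum (i := i) p φ, β =>
      (∑ᶠ a : p.vars → V,
        if (φ.eval A (Function.extend Subtype.val a β) : Prop)
        then p.eval A (Function.extend Subtype.val a β) else 0 : S.carrier i)

end WAExpr

theorem extend_comp_equiv {ι' : Type} (e : V → V') (y : ι' → ℕ) (a : ι' → V) (β : ℕ → V) :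
    Function.extend y (e ∘ a) (e ∘ β) = e ∘ Function.extend y a β := by
  classical
  funext z
  by_cases h : ∃ i, y i = z
  · simp [Function.extend, h]
  · simp [Function.extend, h]

theorem WProduct.eval_iso (e : V ≃ V') (A : WStr σ W V) (B : WStr σ W V') (h : WStr.IsIso e A B)
    (β : ℕ → V) {i : S.ι} (p : WProduct W i) : p.eval B (e ∘ β) = p.eval A β := by
  have key : ∀ {i : S.ι} (t : WFactor W i), t.eval B (e ∘ β) = t.eval A β := by
    intro i t
    cases t with
    | const s => rfl
    | weight w y hy => simp [WFactor.eval, h.2, Function.comp_assoc]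
  simp [WProduct.eval, key]

theorem WAExpr.eval_iso (e : V ≃ V') (A : WStr σ W V) (B : WStr σ W V') (h : WStr.IsIso e A B)
    {o : Option S.ι} (ξ : WAExpr σ W P o) :
    ∀ β : ℕ → V, ξ.eval B (e ∘ β) = ξ.eval A β := by
  induction ξ with
  | eq x y => intro β; simp [eval]
  | rel R x => intro β; simp [eval, h.1, Function.comp_assoc]
  | wtEq w s x hx => intro β; simp [eval, h.2, Function.comp_assoc]
  | neg φ ih => intro β; simp [eval, ih]
  | or φ ψ ih ih' => intro β; simp [eval, ih, ih']
  | ex y φ ih =>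
    intro β
    simp only [eval]
    refine propext ⟨?_, ?_⟩
    · rintro ⟨a, ha⟩
      refine ⟨e.symm a, ?_⟩
      rw [← ih]
      convert ha using 2
      rw [Function.comp_update]; simp
    · rintro ⟨a, ha⟩
      refine ⟨e a, ?_⟩
      rw [← Function.comp_update, ih]; exact ha
  | sumEq w s y hy φ ih =>
    intro β
    simp only [eval]
    congr 1
    rw [← finsum_comp_equiv (Equiv.arrowCongr (Equiv.refl (Fin (W.ar w))) e)]
    refine finsum_congr fun a => ?_
    have : (Equiv.arrowCongr (Equiv.refl (Fin (W.ar w))) e) a = e ∘ a := rfl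
    rw [this, extend_comp_equiv, ih, ← h.2]
  | pred p t ih => intro β; simp only [eval, ih]
  | const s => intro β; rfl
  | weight w x hx => intro β; simp [eval, h.2, Function.comp_assoc]
  | add t t' ih ih' => intro β; simp only [eval, ih, ih']
  | sub t t' ih ih' => intro β; simp only [eval, ih, ih']
  | mul hr t t' ih ih' => intro β; simp only [eval, ih, ih']
  | sum p φ ih =>
    intro β
    simp only [eval]
    rw [← finsum_comp_equiv (Equiv.arrowCongr (Equiv.refl p.vars) e)]
    refine finsum_congr fun a => ?_
    have : (Equiv.arrowCongr (Equiv.refl p.vars) e) a = e ∘ a := rfl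
    rw [this, extend_comp_equiv, ih, WProduct.eval_iso e A B h]

theorem extend_congr {ι' : Type} (y : ι' → ℕ) (a : ι' → V) (β β' : ℕ → V) (z : ℕ)
    (h : (∀ i, y i ≠ z) → β z = β' z) : Function.extend y a β z = Function.extend y a β' z := by
  classical
  by_cases hz : ∃ i, y i = z
  · simp [Function.extend, hz]
  · simpa [Function.extend, hz] using h (by simpa using hz)

theorem WProduct.eval_congr (A : WStr σ W V) (β β' : ℕ → V) {i : S.ι} (p : WProduct W i)
    (h : ∀ x ∈ p.vars, β x = β' x) : p.eval A β = p.eval A β' := by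
  have key : ∀ {i : S.ι} (t : WFactor W i), (∀ x ∈ t.vars, β x = β' x) →
      t.eval A β = t.eval A β' := by
    intro i t ht
    cases t with
    | const s => rfl
    | weight w y hy =>
      have : β ∘ y = β' ∘ y := funext fun j => ht _ (by simp [WFactor.vars])
      simp [WFactor.eval, this]
  have aux : ∀ (l : List (WFactor W i)) (s : S.carrier i),
      (∀ x ∈ l.foldr (fun t Y => t.vars ∪ Y) ∅, β x = β' x) →
      l.foldl (fun s t => S.mul i s (t.eval A β)) s =
        l.foldl (fun s t => S.mul i s (t.eval A β')) s := by
    intro l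
    induction l with
    | nil => intro s _; rfl
    | cons t l ih =>
      intro s hl
      simp only [List.foldr_cons, Finset.mem_union] at hl
      simp only [List.foldl_cons]
      rw [key t fun x hx => hl x (Or.inl hx), ih _ fun x hx => hl x (Or.inr hx)]
  simp only [WProduct.vars, List.foldr_cons, Finset.mem_union] at h
  rw [WProduct.eval, WProduct.eval, key p.head fun x hx => h x (Or.inl hx),
    aux _ _ fun x hx => h x (Or.inr hx)]

theorem WAExpr.eval_congr (A : WStr σ W V) {o : Option S.ι} (ξ : WAExpr σ W P o) :
    ∀ β β' : ℕ → V, (∀ x ∈ ξ.free, β x = β' x) → ξ.eval A β = ξ.eval A β' := by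
  induction ξ with
  | eq x y => intro β β' h; simp [eval, h x (by simp [free]), h y (by simp [free])]
  | rel R x =>
    intro β β' h
    have : β ∘ x = β' ∘ x := funext fun j => h _ (by simp [free])
    simp [eval, this]
  | wtEq w s x hx =>
    intro β β' h
    have : β ∘ x = β' ∘ x := funext fun j => h _ (by simp [free])
    simp [eval, this]
  | neg φ ih => intro β β' h; simp [eval, ih β β' h]
  | or φ ψ ih ih' =>
    intro β β' h
    simp only [free, Finset.mem_union] at h
    simp [eval, ih β β' fun x hx => h x (Or.inl hx), ih' β β' fun x hx => h x (Or.inr hx)]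
  | ex y φ ih =>
    intro β β' h
    simp only [eval]
    congr 1
    funext a
    refine ih _ _ fun x hx => ?_
    by_cases hxy : x = y
    · subst hxy; simp
    · simpa [Function.update, hxy] using h x (by simp [free, hx, hxy])
  | sumEq w s y hy φ ih =>
    intro β β' h
    simp only [eval]
    congr 1
    refine finsum_congr fun a => ?_
    rw [ih _ (Function.extend y a β') fun x hx => extend_congr _ _ _ _ _ fun hn =>
      h x (by simp [free, hx]; exact hn)]
  | pred p t ih =>
    intro β β' h
    simp only [eval]
    congr 1
    funext i
    exact ih i _ _ fun x hx => h x (by simp only [free, Finset.mem_biUnion]; exact ⟨i, by simp, hx⟩)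
  | const s => intro β β' _; rfl
  | weight w x hx =>
    intro β β' h
    have : β ∘ x = β' ∘ x := funext fun j => h _ (by simp [free])
    simp [eval, this]
  | add t t' ih ih' =>
    intro β β' h
    simp only [free, Finset.mem_union] at h
    simp only [eval, ih β β' fun x hx => h x (Or.inl hx), ih' β β' fun x hx => h x (Or.inr hx)]
  | sub t t' ih ih' =>
    intro β β' h
    simp only [free, Finset.mem_union] at h
    simp only [eval, ih β β' fun x hx => h x (Or.inl hx), ih' β β' fun x hx => h x (Or.inr hx)]
  | mul hr t t' ih ih' =>
    intro β β' h
    simp only [free, Finset.mem_union] at h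
    simp only [eval, ih β β' fun x hx => h x (Or.inl hx), ih' β β' fun x hx => h x (Or.inr hx)]
  | sum p φ ih =>
    intro β β' h
    simp only [eval]
    refine finsum_congr fun a => ?_
    rw [ih _ (Function.extend Subtype.val a β') fun x hx => extend_congr _ _ _ _ _ fun hn =>
      h x (by simp only [free, Finset.mem_sdiff]; exact ⟨hx, fun hp => hn ⟨x, hp⟩ rfl⟩)]
    rw [WProduct.eval_congr A _ (Function.extend Subtype.val a β') p fun x hx =>
      extend_congr _ _ _ _ _ fun hn => absurd rfl (hn ⟨x, hx⟩)]

/-- First-order logic with weight aggregation. -/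
def WA (σ : Sig) (W : WSig S) (P : PredColl S) : WLogic σ W where
  Formula := WAExpr σ W P none
  free φ := φ.free
  Sat A β φ := φ.eval A β
  sat_congr A β β' φ h := by rw [WAExpr.eval_congr A φ β β' h]
  sat_iso e A B β φ h := by rw [WAExpr.eval_iso e A B h φ β]

end WA

/-! ### Locality, decompositions, concepts -/

section Learning

variable {S : WeightColl} {σ σs : Sig} {W : WSig S} {V : Type}

namespace WLogic

/-- `φ` is `r`-local around its free variables. (For a formula without free variables there is no
neighbourhood structure, hence no `β'`, and the condition is void.) -/
def IsLocal (L : WLogic.{u} σ W) (r : ℕ) (φ : L.Formula) : Prop :=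
  ∀ {V : Type} [Finite V] (A : WStr σ W V), A.IsWeighted →
    ∀ (β : ℕ → V) (β' : ℕ → A.ball r (β '' (L.free φ : Set ℕ))),
      (∀ x ∈ L.free φ, (β' x : V) = β x) →
        (L.Sat A β φ ↔ L.Sat (A.induce (A.ball r (β '' (L.free φ : Set ℕ)))) β' φ)

/-- `Δ` is a Feferman-Vaught decomposition of `φ` in `Ψ` with respect to `(Z; Z')`. As `φ` does not
use the two predicates that mark the parts of a disjoint sum, it is evaluated in the disjoint
union. -/
def IsFVDecomposition (L : WLogic.{u} σ W) (Ψ : Set L.Formula) (φ : L.Formula) (Z Z' : Finset ℕ)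
    (Δ : Set (L.Formula × L.Formula)) : Prop :=
  Δ.Finite ∧ Δ.Nonempty ∧
  (∀ p ∈ Δ, p.1 ∈ Ψ ∧ p.2 ∈ Ψ ∧ L.free p.1 ⊆ Z ∧ L.free p.2 ⊆ Z') ∧
  ∀ {V V' : Type} [Finite V] [Finite V'] (A : WStr σ W V) (B : WStr σ W V'),
    A.IsWeighted → B.IsWeighted →
    ∀ (β : ℕ → V) (β' : ℕ → V') (γ : ℕ → V ⊕ V'),
      (∀ z ∈ Z, γ z = Sum.inl (β z)) → (∀ z ∈ Z', γ z = Sum.inr (β' z)) →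
        (L.Sat (A.dunion B) γ φ ↔ ∃ p ∈ Δ, L.Sat A β p.1 ∧ L.Sat B β' p.2)

/-- `A ⊨ φ[a, v]` for a formula `φ(x₁,…,x_k,y₁,…,y_ℓ)`; the variables `x₁,…,x_k,y₁,…,y_ℓ` are
`0,…,k-1,k,…,k+ℓ-1`. -/
def Holds (L : WLogic.{u} σ W) [Finite V] (A : WStr σ W V) (φ : L.Formula) {k ℓ : ℕ}
    (a : Fin k → V) (v : Fin ℓ → V) : Prop :=
  ∀ β : ℕ → V, (∀ i : Fin k, β i = a i) → (∀ j : Fin ℓ, β (k + j) = v j) → L.Sat A β φ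

open Classical in
/-- The concept on `V^k` defined by `φ` and the parameters `v`. -/
def concept (L : WLogic.{u} σ W) [Finite V] (A : WStr σ W V) (φ : L.Formula) {k ℓ : ℕ}
    (v : Fin ℓ → V) : (Fin k → V) → Bool :=
  fun a => decide (L.Holds A φ a v)

/-- The concept class `C(Φ, A, k, ℓ)`. -/
def conceptClass (L : WLogic.{u} σ W) [Finite V] (Φ : Set L.Formula) (A : WStr σ W V)
    (k ℓ : ℕ) : Set ((Fin k → V) → Bool) :=
  {h | ∃ φ ∈ Φ, ∃ v : Fin ℓ → V, h = L.concept A φ v}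

end WLogic

/-- The hypothesis `h` is consistent with the training sequence `T`. -/
def Consistent {k : ℕ} (h : (Fin k → V) → Bool) (T : List ((Fin k → V) × Bool)) : Prop :=
  ∀ p ∈ T, h p.1 = p.2

/-- The elements that occur in the training sequence. -/
def trainingElems {k : ℕ} (T : List ((Fin k → V) × Bool)) : Set V :=
  {a | ∃ p ∈ T, ∃ i, p.1 i = a}

/-- `As` is associated with `A`: every formula of `Φ` on `A` is equivalent to some formula of
`Φs` on `As`. -/
def IsAssociated {L : WLogic.{u} σ W} {Ls : WLogic.{v} σs W} (k ℓ : ℕ) (Φ : Set L.Formula)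
    (Φs : Set Ls.Formula) [Finite V] (A : WStr σ W V) (As : WStr σs W V) : Prop :=
  As.IsWeighted ∧ ∀ φ ∈ Φ, ∃ ψ ∈ Φs, ∀ (a : Fin k → V) (v : Fin ℓ → V),
    L.Holds A φ a v ↔ Ls.Holds As ψ a v

/-- `Φs` is a finite set of `r`-local normal forms for `Φ`: the requirements on `Φ` and `Φs`. -/
structure HasLocalNormalForms {L : WLogic.{u} σ W} {Ls : WLogic.{v} σs W} (k ℓ r : ℕ)
    (Φ : Set L.Formula) (Φs : Set Ls.Formula) : Prop where
  free_subset : ∀ φ ∈ Φ, L.free φ ⊆ Finset.range (k + ℓ)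
  free_subset_star : ∀ φ ∈ Φs, Ls.free φ ⊆ Finset.range (k + ℓ)
  finite : Φs.Finite
  isLocal : ∀ φ ∈ Φs, Ls.IsLocal r φ
  associated : ∀ {V : Type} [Finite V] [Nonempty V] (A : WStr σ W V), A.IsWeighted →
    ∃ As : WStr σs W V, IsAssociated k ℓ Φ Φs A As
  fv : ∀ φ ∈ Φs, ∀ Z Z' : Finset ℕ, Z.Nonempty → Z'.Nonempty → Disjoint Z Z' →
    Z ∪ Z' = Ls.free φ → ∃ Δ, Ls.IsFVDecomposition Φs φ Z Z' Δ
  neg : ∀ φ ∈ Φs, ∃ ψ ∈ Φs, ∀ {V : Type} [Finite V] (A : WStr σs W V), A.IsWeighted →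
    ∀ β : ℕ → V, Ls.Sat A β ψ ↔ ¬ Ls.Sat A β φ
  or : ∀ φ₁ ∈ Φs, ∀ φ₂ ∈ Φs, ∃ ψ ∈ Φs, ∀ {V : Type} [Finite V] (A : WStr σs W V),
    A.IsWeighted → ∀ β : ℕ → V, Ls.Sat A β ψ ↔ (Ls.Sat A β φ₁ ∨ Ls.Sat A β φ₂)

/-! ### Algorithms with local access

Programs of a WHILE language over binary trees. The leaves of the trees are `nil`, elements of the
universe and weights. A program contains no name of an element, so it gets hold of elements only
through its input and through queries for the neighbours of elements that it already has. -/

/-- Values of program variables. -/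
inductive Val (S : WeightColl) (V : Type) : Type
  | nil : Val S V
  | elem (a : V) : Val S V
  | wt (i : S.ι) (s : S.carrier i) : Val S V
  | cons (x y : Val S V) : Val S V

namespace Val

def ofList : List (Val S V) → Val S V
  | [] => nil
  | x :: l => cons x (ofList l)

/-- The list of the elements of a tuple. -/
def tuple {n : ℕ} (a : Fin n → V) : Val S V := ofList (List.ofFn fun i => elem (a i))

/-- Truth values; `nil` is false, and every other value counts as true. -/
def bool (b : Bool) : Val S V := if b then cons nil nil else nil

/-- Natural numbers in unary. -/
def num : ℕ → Val S V
  | 0 => nil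
  | n + 1 => cons nil (num n)

def hd : Val S V → Val S V
  | cons x _ => x
  | _ => nil

def tl : Val S V → Val S V
  | cons _ y => y
  | _ => nil

def isCons : Val S V → Bool
  | cons _ _ => true
  | _ => false

open Classical in
/-- Equality of leaves. -/
def eqLeaf (x y : Val S V) : Val S V := bool (decide (x = y ∧ x.isCons = false))

open Classical in
/-- An operation on weights of the same type. -/
def op (f : ∀ i, S.carrier i → S.carrier i → Option (S.carrier i)) : Val S V → Val S V → Val S V
  | wt i s, wt j s' =>
      if h : j = i then
        match f i s (h ▸ s') with
        | some s'' => wt i s''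
        | none => nil
      else nil
  | _, _ => nil

/-- A training sequence as a list of pairs. -/
def training {k : ℕ} (T : List ((Fin k → V) × Bool)) : Val S V :=
  ofList (T.map fun p => cons (tuple p.1) (bool p.2))

end Val

/-- The expressions of the programming language. -/
inductive PExp (σ : Sig) (W : WSig S) (P : PredColl S) : Type
  | var (x : ℕ)
  | nil
  | cons (e e' : PExp σ W P)
  | hd (e : PExp σ W P)
  | tl (e : PExp σ W P)
  | eq (e e' : PExp σ W P)
  | const (i : S.ι) (s : S.carrier i)
  | add (e e' : PExp σ W P)
  | sub (e e' : PExp σ W P)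
  | mul (e e' : PExp σ W P)
  | pred (p : P.Name) (e : PExp σ W P)
  | rel (R : σ.Rel) (e : PExp σ W P)
  | wt (w : W.Sym) (e : PExp σ W P)
  | nbrs (e : PExp σ W P)

/-- Programs. `call x c e` runs `c` as a subroutine with variables of its own on the value of `e`
and stores the result in `x`. -/
inductive Prog (σ : Sig) (W : WSig S) (P : PredColl S) : Type
  | assign (x : ℕ) (e : PExp σ W P)
  | seq (c c' : Prog σ W P)
  | ite (e : PExp σ W P) (c c' : Prog σ W P)
  | loop (e : PExp σ W P) (c : Prog σ W P)
  | call (x : ℕ) (c : Prog σ W P) (e : PExp σ W P)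

/-- Answers to the queries for the neighbours of an element: lists in an arbitrary order. -/
structure WStr.Access (A : WStr σ W V) where
  nbrs : V → List V
  nodup : ∀ a, (nbrs a).Nodup
  mem_nbrs : ∀ a b, b ∈ nbrs a ↔ A.gaifman.Adj a b

variable {P : PredColl S}

/-- The number of bits of the name of an element. -/
def nameLen (V : Type) : ℕ := Nat.log 2 (Nat.card V) + 1

namespace PExp

open Classical in
/-- The value of an expression; ill-formed queries and operations have the value `nil`. -/
def val {A : WStr σ W V} (acc : A.Access) (s : ℕ → Val S V) : PExp σ W P → Val S V
  | var x => s x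
  | nil => .nil
  | cons e e' => .cons (e.val acc s) (e'.val acc s)
  | hd e => (e.val acc s).hd
  | tl e => (e.val acc s).tl
  | eq e e' => Val.eqLeaf (e.val acc s) (e'.val acc s)
  | const i a => .wt i a
  | add e e' => Val.op (fun _ a b => some (a + b)) (e.val acc s) (e'.val acc s)
  | sub e e' => Val.op (fun _ a b => some (a - b)) (e.val acc s) (e'.val acc s)
  | mul e e' => Val.op S.mul? (e.val acc s) (e'.val acc s)
  | pred p e => Val.bool (decide (∃ t ∈ P.sem p,
      e.val acc s = Val.ofList (List.ofFn fun i => Val.wt (P.type p i) (t i))))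
  | rel R e => Val.bool (decide (∃ t ∈ A.rel R, e.val acc s = Val.tuple t))
  | wt w e =>
      if h : ∃ t : Fin (W.ar w) → V, e.val acc s = Val.tuple t then .wt _ (A.wt w h.choose)
      else .nil
  | nbrs e =>
      match e.val acc s with
      | .elem a => Val.ofList ((acc.nbrs a).map Val.elem)
      | _ => .nil

/-- The time for the evaluation of an expression: every operation takes one unit of time, and in
addition every name of an element that is compared, passed to a query or returned by a query takes
its length. -/
def cost {A : WStr σ W V} (acc : A.Access) (s : ℕ → Val S V) : PExp σ W P → ℕ
  | var _ => 1
  | nil => 1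
  | cons e e' => e.cost acc s + e'.cost acc s + 1
  | hd e => e.cost acc s + 1
  | tl e => e.cost acc s + 1
  | eq e e' => e.cost acc s + e'.cost acc s + 1 + 2 * nameLen V
  | const _ _ => 1
  | add e e' => e.cost acc s + e'.cost acc s + 1
  | sub e e' => e.cost acc s + e'.cost acc s + 1
  | mul e e' => e.cost acc s + e'.cost acc s + 1
  | pred _ e => e.cost acc s + 1
  | rel R e => e.cost acc s + 1 + σ.ar R * nameLen V
  | wt w e => e.cost acc s + 1 + W.ar w * nameLen V
  | nbrs e => e.cost acc s + 1 +
      match e.val acc s with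
      | .elem a => ((acc.nbrs a).length + 1) * nameLen V
      | _ => 0

end PExp

/-- The store in which variable `0` holds the input. -/
def initStore (x : Val S V) : ℕ → Val S V := Function.update (fun _ => Val.nil) 0 x

/-- `Exec acc c s s' t`: started in the store `s`, the program `c` halts after time `t` in the
store `s'`. -/
inductive Exec {A : WStr σ W V} (acc : A.Access) :
    Prog σ W P → (ℕ → Val S V) → (ℕ → Val S V) → ℕ → Prop
  | assign (x : ℕ) (e : PExp σ W P) (s : ℕ → Val S V) :
      Exec acc (.assign x e) s (Function.update s x (e.val acc s)) (e.cost acc s + 1)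
  | seq {c c' : Prog σ W P} {s s' s'' : ℕ → Val S V} {t t' : ℕ} :
      Exec acc c s s' t → Exec acc c' s' s'' t' → Exec acc (.seq c c') s s'' (t + t')
  | ite_true {e : PExp σ W P} {c c' : Prog σ W P} {s s' : ℕ → Val S V} {t : ℕ} :
      e.val acc s ≠ .nil → Exec acc c s s' t →
      Exec acc (.ite e c c') s s' (e.cost acc s + 1 + t)
  | ite_false {e : PExp σ W P} {c c' : Prog σ W P} {s s' : ℕ → Val S V} {t : ℕ} :
      e.val acc s = .nil → Exec acc c' s s' t →
      Exec acc (.ite e c c') s s' (e.cost acc s + 1 + t)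
  | loop_done {e : PExp σ W P} {c : Prog σ W P} {s : ℕ → Val S V} :
      e.val acc s = .nil → Exec acc (.loop e c) s s (e.cost acc s + 1)
  | loop_step {e : PExp σ W P} {c : Prog σ W P} {s s' s'' : ℕ → Val S V} {t t' : ℕ} :
      e.val acc s ≠ .nil → Exec acc c s s' t → Exec acc (.loop e c) s' s'' t' →
      Exec acc (.loop e c) s s'' (e.cost acc s + 1 + t + t')
  | call {x : ℕ} {c : Prog σ W P} {e : PExp σ W P} {s s' : ℕ → Val S V} {t : ℕ} :
      Exec acc c (initStore (e.val acc s)) s' t →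
      Exec acc (.call x c e) s (Function.update s x (s' 0)) (e.cost acc s + 1 + t)

/-- Programs are deterministic: the final store and the running time are unique. -/
theorem Exec.unique {A : WStr σ W V} {acc : A.Access} {c : Prog σ W P} {s s₁ s₂ : ℕ → Val S V}
    {t₁ t₂ : ℕ} (h₁ : Exec acc c s s₁ t₁) (h₂ : Exec acc c s s₂ t₂) : s₁ = s₂ ∧ t₁ = t₂ := by
  induction h₁ generalizing s₂ t₂ with
  | assign x e s => cases h₂; exact ⟨rfl, rfl⟩
  | seq _ _ ih ih' =>
    cases h₂ with
    | seq g g' =>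
      obtain ⟨rfl, rfl⟩ := ih g
      obtain ⟨rfl, rfl⟩ := ih' g'
      exact ⟨rfl, rfl⟩
  | ite_true h _ ih =>
    cases h₂ with
    | ite_true _ g => obtain ⟨rfl, rfl⟩ := ih g; exact ⟨rfl, rfl⟩
    | ite_false h' _ => exact absurd h' h
  | ite_false h _ ih =>
    cases h₂ with
    | ite_false _ g => obtain ⟨rfl, rfl⟩ := ih g; exact ⟨rfl, rfl⟩
    | ite_true h' _ => exact absurd h h'
  | loop_done h =>
    cases h₂ with
    | loop_done _ => exact ⟨rfl, rfl⟩
    | loop_step h' _ _ => exact absurd h h'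
  | loop_step h _ _ ih ih' =>
    cases h₂ with
    | loop_done h' => exact absurd h' h
    | loop_step _ g g' =>
      obtain ⟨rfl, rfl⟩ := ih g
      obtain ⟨rfl, rfl⟩ := ih' g'
      exact ⟨rfl, rfl⟩
  | call _ ih =>
    cases h₂ with
    | call g => obtain ⟨rfl, rfl⟩ := ih g; exact ⟨rfl, rfl⟩

/-- On input `x`, the program `c` halts with output `y` after time `t`. -/
def Prog.Runs (c : Prog σ W P) {A : WStr σ W V} (acc : A.Access) (x y : Val S V) (t : ℕ) : Prop :=
  ∃ s, Exec acc c (initStore x) s t ∧ s 0 = y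

/-- Model checking for the formulas `Φs i` on `A` by the programs `mc i` takes time at most `F`:
on input of a tuple `(a, v)`, the program `mc i` decides within this time whether
`A ⊨ Φs i [a, v]`. -/
def ModelChecksWithin {L : WLogic.{u} σ W} {N : ℕ} (k ℓ : ℕ) (Φs : Fin N → L.Formula)
    (mc : Fin N → Prog σ W P) [Finite V] (A : WStr σ W V) (F : ℕ) : Prop :=
  ∀ (acc : A.Access) (i : Fin N) (a : Fin k → V) (v : Fin ℓ → V),
    ∃ (y : Val S V) (t : ℕ), (mc i).Runs acc (Val.tuple (Fin.append a v)) y t ∧ t ≤ F ∧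
      (y ≠ .nil ↔ L.Holds A (Φs i) a v)

end Learning

end

/-!
Parameters that are linked to the training elements by steps of length at most `2r+1` stay within
distance `(2r+1)ℓ` of them. The remaining parameters are so far away that, by `r`-locality, they
may be interpreted in a second, disjoint copy of the structure. A Feferman-Vaught decomposition
then splits them off, and as they are the same for all examples, they only contribute fixed truth
values. Hence a formula with these parameters is equivalent, on the training examples, to a Boolean
combination of the other components, which uses near parameters only. So the learner may try all
formulas with all parameters from the neighbourhood of the training elements, and for fixed `ℓ`
and `r` the number of these is polynomial in the degree and in the length of the training sequence.
-/

/-! ### Gaifman neighbourhoods -/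

theorem edist_le_succ_iff {V : Type*} {G : SimpleGraph V} {a b : V} {n : ℕ} :
    G.edist a b ≤ (n + 1 : ℕ) ↔ G.edist a b ≤ n ∨ ∃ c, G.edist a c ≤ n ∧ G.Adj c b := by
  constructor
  · intro h
    obtain ⟨p, hp⟩ := (SimpleGraph.edist_ne_top_iff_reachable.1
      (ne_top_of_le_ne_top (by simp) h)).exists_walk_length_eq_edist
    have hlen : p.length ≤ n + 1 := by exact_mod_cast hp.trans_le h
    by_cases hnil : p.Nil
    · exact Or.inl (by simp [← hp, SimpleGraph.Walk.length_eq_zero_iff.2 hnil])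
    · have hdrop := p.length_dropLast_add_one hnil
      refine Or.inr ⟨p.penultimate, p.dropLast.edist_le.trans ?_, p.adj_penultimate hnil⟩
      exact_mod_cast (by omega : p.dropLast.length ≤ n)
  · rintro (h | ⟨c, h, hadj⟩)
    · exact h.trans (by exact_mod_cast n.le_succ)
    · rw [Nat.cast_add, Nat.cast_one]
      exact SimpleGraph.edist_triangle.trans
        (add_le_add h (SimpleGraph.edist_eq_one_iff_adj.2 hadj).le)

namespace WStr

variable {S : WeightColl} {σ : Sig} {W : WSig S} {V : Type}

theorem ball_zero (A : WStr σ W V) (X : Set V) : A.ball 0 X = X := by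
  ext b
  simp [ball]

theorem ball_mono (A : WStr σ W V) {r r' : ℕ} (h : r ≤ r') (X : Set V) :
    A.ball r X ⊆ A.ball r' X :=
  fun _ ⟨a, ha, hr⟩ => ⟨a, ha, hr.trans (by exact_mod_cast h)⟩

theorem subset_ball (A : WStr σ W V) (r : ℕ) (X : Set V) : X ⊆ A.ball r X :=
  fun a ha => ⟨a, ha, by simp⟩

theorem ball_union (A : WStr σ W V) (r : ℕ) (X Y : Set V) :
    A.ball r (X ∪ Y) = A.ball r X ∪ A.ball r Y := by
  ext b
  simp only [ball, Set.mem_union, Set.mem_ofPred_eq, or_and_right, exists_or]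

theorem mem_ball_succ {A : WStr σ W V} {r : ℕ} {X : Set V} {b : V} :
    b ∈ A.ball (r + 1) X ↔ b ∈ A.ball r X ∨ ∃ c ∈ A.ball r X, A.gaifman.Adj c b := by
  simp only [ball, Set.mem_ofPred_eq, edist_le_succ_iff]
  constructor
  · rintro ⟨a, ha, h | ⟨c, hc, hadj⟩⟩
    exacts [Or.inl ⟨a, ha, h⟩, Or.inr ⟨c, ⟨a, ha, hc⟩, hadj⟩]
  · rintro (⟨a, ha, h⟩ | ⟨c, ⟨a, ha, hc⟩, hadj⟩)
    exacts [⟨a, ha, Or.inl h⟩, ⟨a, ha, Or.inr ⟨c, hc, hadj⟩⟩]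

theorem mem_ball_add {A : WStr σ W V} {r s : ℕ} {X : Set V} {a b : V} (ha : a ∈ A.ball r X)
    (hab : A.gaifman.edist a b ≤ s) : b ∈ A.ball (r + s) X := by
  obtain ⟨x, hx, hxa⟩ := ha
  exact ⟨x, hx, (SimpleGraph.edist_triangle (v := a)).trans
    ((add_le_add hxa hab).trans_eq (Nat.cast_add r s).symm)⟩

theorem exists_near_params (A : WStr σ W V) {ι : Type*} [Fintype ι] (s : ℕ) (X : Set V)
    (v : ι → V) :
    ∃ J : Finset ι, (∀ j ∈ J, v j ∈ A.ball (s * Fintype.card ι) X) ∧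
      (∀ j ∉ J, ∀ x ∈ X, ¬ A.gaifman.edist x (v j) ≤ s) ∧
      (∀ j ∉ J, ∀ i ∈ J, ¬ A.gaifman.edist (v i) (v j) ≤ s) := by
  classical
  let near (J : Finset ι) : Prop := ∀ j ∈ J, v j ∈ A.ball (s * J.card) X
  obtain ⟨J, hJ, hmax⟩ := Finset.exists_max_image (Finset.univ.filter near) Finset.card
    ⟨∅, by simp [near]⟩
  simp only [Finset.mem_filter, Finset.mem_univ, true_and] at hJ hmax
  have hfar : ∀ j ∉ J, v j ∉ A.ball (s * J.card + s) X := by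
    intro j hj hmem
    have hinsert : near (insert j J) := by
      intro i hi
      rw [Finset.card_insert_of_notMem hj, Nat.mul_succ]
      rcases Finset.mem_insert.1 hi with rfl | hi
      exacts [hmem, A.ball_mono (Nat.le_add_right _ _) X (hJ i hi)]
    have hcard := hmax _ hinsert
    rw [Finset.card_insert_of_notMem hj] at hcard
    omega
  exact ⟨J, fun j hj => A.ball_mono (Nat.mul_le_mul_left s J.card_le_univ) X (hJ j hj),
    fun j hj x hx h => hfar j hj (mem_ball_add (A.subset_ball _ X hx) h),
    fun j hj i hi h => hfar j hj (mem_ball_add (hJ i hi) h)⟩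

end WStr

/-! ### Disjoint unions -/

theorem sumTuple_cases {ι α β : Type*} (c : ι → α ⊕ β) :
    (∃ a, c = Sum.inl ∘ a) ∨ (∃ b, c = Sum.inr ∘ b) ∨
      ∃ i j a b, c i = Sum.inl a ∧ c j = Sum.inr b := by
  by_cases hl : ∀ i, ∃ a, c i = Sum.inl a
  · choose a ha using hl
    exact Or.inl ⟨a, funext ha⟩
  by_cases hr : ∀ i, ∃ b, c i = Sum.inr b
  · choose b hb using hr
    exact Or.inr (Or.inl ⟨b, funext hb⟩)
  push Not at hl hr
  obtain ⟨⟨j, hj⟩, ⟨i, hi⟩⟩ := hl, hr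
  rcases hci : c i with a | b
  · rcases hcj : c j with a' | b
    · exact absurd hcj (hj a')
    · exact Or.inr (Or.inr ⟨i, j, a, b, hci, hcj⟩)
  · exact absurd hci (hi b)

namespace WStr

variable {S : WeightColl} {σ : Sig} {W : WSig S} {V V' : Type}

theorem dunion_wt_inl (A : WStr σ W V) (B : WStr σ W V') (w : W.Sym) (a : Fin (W.ar w) → V) :
    (A.dunion B).wt w (Sum.inl ∘ a) = A.wt w a := by
  have h : ∃ a', (Sum.inl ∘ a : Fin (W.ar w) → V ⊕ V') = Sum.inl ∘ a' := ⟨a, rfl⟩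
  simp only [dunion]
  rw [dif_pos h, ← Sum.inl_injective.comp_left h.choose_spec]

theorem dunion_wt_inr (A : WStr σ W V) (B : WStr σ W V') (w : W.Sym) (b : Fin (W.ar w) → V') :
    (A.dunion B).wt w (Sum.inr ∘ b) = B.wt w b := by
  have h : ∃ b', (Sum.inr ∘ b : Fin (W.ar w) → V ⊕ V') = Sum.inr ∘ b' := ⟨b, rfl⟩
  have hinl : ¬ ∃ a, (Sum.inr ∘ b : Fin (W.ar w) → V ⊕ V') = Sum.inl ∘ a :=
    fun ⟨_, ha⟩ => Sum.inr_ne_inl (congrFun ha ⟨0, W.ar_pos w⟩)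
  simp only [dunion]
  rw [dif_neg hinl, dif_pos h, ← Sum.inr_injective.comp_left h.choose_spec]

theorem dunion_wt_of_inl_of_inr (A : WStr σ W V) (B : WStr σ W V') {w : W.Sym}
    {c : Fin (W.ar w) → V ⊕ V'} {i j : Fin (W.ar w)} {a : V} {b : V'} (hi : c i = Sum.inl a)
    (hj : c j = Sum.inr b) : (A.dunion B).wt w c = 0 := by
  simp only [dunion]
  rw [dif_neg, dif_neg]
  · rintro ⟨b', rfl⟩
    exact Sum.inr_ne_inl hi
  · rintro ⟨a', rfl⟩
    exact Sum.inl_ne_inr hj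

theorem IsWeighted.dunion {A : WStr σ W V} {B : WStr σ W V'} (hA : A.IsWeighted)
    (hB : B.IsWeighted) : (A.dunion B).IsWeighted := by
  intro w c hc
  rcases sumTuple_cases c with ⟨a, rfl⟩ | ⟨b, rfl⟩ | ⟨i, j, a, b, hi, hj⟩
  · rw [dunion_wt_inl] at hc
    refine (hA w a hc).imp_right (Or.imp (fun h i j => congrArg Sum.inl (h i j)) ?_)
    rintro ⟨R, t, ht, hsub⟩
    refine ⟨R, Sum.inl ∘ t, Or.inl ⟨t, ht, rfl⟩, ?_⟩
    simpa only [Set.range_comp] using Set.image_mono hsub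
  · rw [dunion_wt_inr] at hc
    refine (hB w b hc).imp_right (Or.imp (fun h i j => congrArg Sum.inr (h i j)) ?_)
    rintro ⟨R, t, ht, hsub⟩
    refine ⟨R, Sum.inr ∘ t, Or.inr ⟨t, ht, rfl⟩, ?_⟩
    simpa only [Set.range_comp] using Set.image_mono hsub
  · exact absurd (dunion_wt_of_inl_of_inr A B hi hj) hc

theorem dunion_gaifman (A : WStr σ W V) (B : WStr σ W V') :
    (A.dunion B).gaifman = A.gaifman ⊕g B.gaifman := by
  ext x y
  constructor
  · rintro ⟨hne, R, t, ⟨s, hs, rfl⟩ | ⟨s, hs, rfl⟩, ⟨i, rfl⟩, ⟨j, rfl⟩⟩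
    · exact ⟨fun h => hne (congrArg Sum.inl h), R, s, hs, ⟨i, rfl⟩, ⟨j, rfl⟩⟩
    · exact ⟨fun h => hne (congrArg Sum.inr h), R, s, hs, ⟨i, rfl⟩, ⟨j, rfl⟩⟩
  · intro h
    rcases x with a | b <;> rcases y with a' | b'
    · obtain ⟨hne, R, s, hs, ⟨i, rfl⟩, ⟨j, rfl⟩⟩ := h
      exact ⟨fun h => hne (Sum.inl_injective h), R, Sum.inl ∘ s, Or.inl ⟨s, hs, rfl⟩,
        ⟨i, rfl⟩, ⟨j, rfl⟩⟩
    · exact absurd h Bool.false_ne_true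
    · exact absurd h Bool.false_ne_true
    · obtain ⟨hne, R, s, hs, ⟨i, rfl⟩, ⟨j, rfl⟩⟩ := h
      exact ⟨fun h => hne (Sum.inr_injective h), R, Sum.inr ∘ s, Or.inr ⟨s, hs, rfl⟩,
        ⟨i, rfl⟩, ⟨j, rfl⟩⟩

theorem ball_dunion (A : WStr σ W V) (B : WStr σ W V') (r : ℕ) (X : Set V) (Y : Set V') :
    (A.dunion B).ball r (Sum.inl '' X ∪ Sum.inr '' Y) =
      Sum.inl '' A.ball r X ∪ Sum.inr '' B.ball r Y := by
  induction r with
  | zero => simp only [ball_zero]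
  | succ r ih =>
    ext z
    rw [mem_ball_succ, ih]
    rcases z with z | z <;> simp [dunion_gaifman, mem_ball_succ]

/-- Two sets without a common element and without an edge of the Gaifman graph between them. The
substructure induced on their union is the disjoint union of those induced on the two sets. -/
def Separated (A : WStr σ W V) (B C : Set V) : Prop :=
  ∀ p ∈ B, ∀ q ∈ C, p ≠ q ∧ ¬ A.gaifman.Adj p q

theorem separated_ball {A : WStr σ W V} {r : ℕ} {X Y : Set V}
    (hXY : ∀ x ∈ X, ∀ y ∈ Y, ¬ A.gaifman.edist x y ≤ (2 * r + 1 : ℕ)) :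
    A.Separated (A.ball r X) (A.ball r Y) := by
  rintro p ⟨x, hx, hp⟩ q ⟨y, hy, hq⟩
  rw [← not_or, or_comm, ← SimpleGraph.edist_le_one_iff_adj_or_eq]
  intro hpq
  refine hXY x hx y hy ?_
  calc A.gaifman.edist x y ≤ A.gaifman.edist x p + A.gaifman.edist p q + A.gaifman.edist q y :=
        SimpleGraph.edist_triangle.trans (add_le_add_left SimpleGraph.edist_triangle _)
    _ ≤ r + 1 + r := add_le_add (add_le_add hp hpq) (SimpleGraph.edist_comm.trans_le hq)
    _ = (2 * r + 1 : ℕ) := by push_cast; ring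

namespace Separated

variable {A : WStr σ W V} {B C : Set V}

theorem notMem_rel (h : A.Separated B C) {R : σ.Rel} {t : Fin (σ.ar R) → V} {i j : Fin (σ.ar R)}
    (hi : t i ∈ B) (hj : t j ∈ C) : t ∉ A.rel R := fun ht =>
  have ⟨hne, hadj⟩ := h _ hi _ hj
  hadj ⟨hne, R, t, ht, ⟨i, rfl⟩, ⟨j, rfl⟩⟩

theorem wt_eq_zero (h : A.Separated B C) (hA : A.IsWeighted) {w : W.Sym} {t : Fin (W.ar w) → V}
    {i j : Fin (W.ar w)} (hi : t i ∈ B) (hj : t j ∈ C) : A.wt w t = 0 := by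
  have hne := (h _ hi _ hj).1
  by_contra hwt
  rcases hA w t hwt with har | hconst | ⟨R, b, hb, hsub⟩
  · exact hne (congrArg t (Fin.ext (by omega)))
  · exact hne (hconst i j)
  · obtain ⟨i', hi'⟩ := hsub ⟨i, rfl⟩
    obtain ⟨j', hj'⟩ := hsub ⟨j, rfl⟩
    exact h.notMem_rel (hi' ▸ hi) (hj' ▸ hj) hb

theorem bijOn (h : A.Separated B C) :
    Set.BijOn (Sum.elim id id : V ⊕ V → V) (Sum.inl '' B ∪ Sum.inr '' C) (B ∪ C) := by
  refine ⟨?_, ?_, ?_⟩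
  · rintro _ (⟨p, hp, rfl⟩ | ⟨q, hq, rfl⟩)
    exacts [Or.inl hp, Or.inr hq]
  · rintro _ (⟨p, hp, rfl⟩ | ⟨q, hq, rfl⟩) _ (⟨p', hp', rfl⟩ | ⟨q', hq', rfl⟩) heq
    · exact congrArg Sum.inl heq
    · exact absurd heq (h p hp q' hq').1
    · exact absurd heq.symm (h p' hp' q hq).1
    · exact congrArg Sum.inr heq
  · rintro p (hp | hp)
    exacts [⟨Sum.inl p, Or.inl ⟨p, hp, rfl⟩, rfl⟩, ⟨Sum.inr p, Or.inr ⟨p, hp, rfl⟩, rfl⟩]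

theorem mem_dunion_self_rel (h : A.Separated B C) {R : σ.Rel} {c : Fin (σ.ar R) → V ⊕ V}
    (hc : ∀ i, c i ∈ Sum.inl '' B ∪ Sum.inr '' C) :
    c ∈ (A.dunion A).rel R ↔ Sum.elim id id ∘ c ∈ A.rel R := by
  constructor
  · rintro (⟨a, ha, rfl⟩ | ⟨a, ha, rfl⟩) <;> exact ha
  · intro hmem
    rcases sumTuple_cases c with ⟨a, rfl⟩ | ⟨b, rfl⟩ | ⟨i, j, p, q, hi, hj⟩
    · exact Or.inl ⟨a, hmem, rfl⟩
    · exact Or.inr ⟨b, hmem, rfl⟩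
    · exact absurd hmem (h.notMem_rel (i := i) (j := j) (by simpa [hi] using hc i)
        (by simpa [hj] using hc j))

theorem dunion_self_wt (h : A.Separated B C) (hA : A.IsWeighted) {w : W.Sym}
    {c : Fin (W.ar w) → V ⊕ V} (hc : ∀ i, c i ∈ Sum.inl '' B ∪ Sum.inr '' C) :
    (A.dunion A).wt w c = A.wt w (Sum.elim id id ∘ c) := by
  rcases sumTuple_cases c with ⟨a, rfl⟩ | ⟨b, rfl⟩ | ⟨i, j, p, q, hi, hj⟩
  · exact dunion_wt_inl A A w a
  · exact dunion_wt_inr A A w b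
  · rw [dunion_wt_of_inl_of_inr A A hi hj,
      h.wt_eq_zero hA (i := i) (j := j) (by simpa [hi] using hc i) (by simpa [hj] using hc j)]

theorem isIso (h : A.Separated B C) (hA : A.IsWeighted) :
    IsIso (h.bijOn.equiv _) ((A.dunion A).induce (Sum.inl '' B ∪ Sum.inr '' C))
      (A.induce (B ∪ C)) :=
  ⟨fun _ t => h.mem_dunion_self_rel fun i => (t i).2,
    fun _ t => h.dunion_self_wt hA fun i => (t i).2⟩

end Separated

end WStr

/-! ### Eliminating far variables -/

namespace WLogic

section

variable {S : WeightColl} {σ : Sig} {W : WSig S} {V V' : Type} {L : WLogic.{u} σ W} {r : ℕ}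
  {φ : L.Formula}

theorem IsLocal.sat_iff (hφ : L.IsLocal r φ) (hfree : (L.free φ).Nonempty) [Finite V] [Finite V']
    {A : WStr σ W V} {B : WStr σ W V'} (hA : A.IsWeighted) (hB : B.IsWeighted) {β : ℕ → V}
    {γ : ℕ → V'} {s : Set V} {t : Set V'} (hs : s = A.ball r (β '' L.free φ))
    (ht : t = B.ball r (γ '' L.free φ)) {e : s ≃ t}
    (he : WStr.IsIso e (A.induce s) (B.induce t))
    (hval : ∀ x ∈ L.free φ, ∀ h : β x ∈ s, (e ⟨β x, h⟩ : V') = γ x) :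
    L.Sat A β φ ↔ L.Sat B γ φ := by
  classical
  subst hs ht
  obtain ⟨x₀, hx₀⟩ := hfree
  have hmem (x) (hx : x ∈ L.free φ) : β x ∈ A.ball r (β '' L.free φ) :=
    A.subset_ball r _ ⟨x, hx, rfl⟩
  let β' (x : ℕ) : A.ball r (β '' L.free φ) :=
    if h : x ∈ L.free φ then ⟨β x, hmem x h⟩ else ⟨β x₀, hmem x₀ hx₀⟩
  have hβ' (x) (hx : x ∈ L.free φ) : β' x = ⟨β x, hmem x hx⟩ := dif_pos hx
  calc L.Sat A β φ ↔ L.Sat (A.induce _) β' φ := hφ A hA β β' fun x hx => by rw [hβ' x hx]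
    _ ↔ L.Sat (B.induce _) (e ∘ β') φ := L.sat_iso e _ _ β' φ he
    _ ↔ L.Sat B γ φ := (hφ B hB γ (e ∘ β') fun x hx => by
        rw [Function.comp_apply, hβ' x hx, hval x hx]).symm

variable [Finite V] {A : WStr σ W V} {Z Z' : Finset ℕ}

theorem IsLocal.sat_dunion_self_iff (hφ : L.IsLocal r φ) (hA : A.IsWeighted) (hZ : Z.Nonempty)
    (hunion : Z ∪ Z' = L.free φ) {β : ℕ → V} {γ : ℕ → V ⊕ V} (hγ : ∀ z ∈ Z, γ z = .inl (β z))
    (hγ' : ∀ z ∈ Z', γ z = .inr (β z))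
    (hfar : ∀ z ∈ Z, ∀ z' ∈ Z', ¬ A.gaifman.edist (β z) (β z') ≤ (2 * r + 1 : ℕ)) :
    L.Sat (A.dunion A) γ φ ↔ L.Sat A β φ := by
  have hsep : A.Separated (A.ball r (β '' Z)) (A.ball r (β '' Z')) := WStr.separated_ball (by
    rintro _ ⟨z, hz, rfl⟩ _ ⟨z', hz', rfl⟩
    exact hfar z hz z' hz')
  refine hφ.sat_iff (hunion ▸ hZ.mono Finset.subset_union_left) (hA.dunion hA) hA ?_ ?_
    (hsep.isIso hA) fun x hx _ => ?_
  · rw [← hunion, Finset.coe_union, Set.image_union, Set.image_congr hγ, Set.image_congr hγ',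
      ← Set.image_image Sum.inl β, ← Set.image_image Sum.inr β, WStr.ball_dunion]
  · rw [← hunion, Finset.coe_union, Set.image_union, WStr.ball_union]
  · change Sum.elim id id (γ x) = β x
    rw [← hunion, Finset.mem_union] at hx
    rcases hx with hx | hx
    · simp [hγ x hx]
    · simp [hγ' x hx]

theorem IsFVDecomposition.sat_iff {Ψ : Set L.Formula} {Δ : Set (L.Formula × L.Formula)}
    (hΔ : L.IsFVDecomposition Ψ φ Z Z' Δ) (hφ : L.IsLocal r φ) (hA : A.IsWeighted)
    (hZ : Z.Nonempty) (hdisj : Disjoint Z Z') (hunion : Z ∪ Z' = L.free φ) {β : ℕ → V}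
    (hfar : ∀ z ∈ Z, ∀ z' ∈ Z', ¬ A.gaifman.edist (β z) (β z') ≤ (2 * r + 1 : ℕ)) :
    L.Sat A β φ ↔ ∃ p ∈ Δ, L.Sat A β p.1 ∧ L.Sat A β p.2 := by
  let γ (x : ℕ) : V ⊕ V := if x ∈ Z then .inl (β x) else .inr (β x)
  have hγ (z) (hz : z ∈ Z) : γ z = .inl (β z) := if_pos hz
  have hγ' (z) (hz : z ∈ Z') : γ z = .inr (β z) := if_neg (Finset.disjoint_right.1 hdisj hz)
  rw [← hφ.sat_dunion_self_iff hA hZ hunion hγ hγ' hfar]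
  exact hΔ.2.2.2 A A hA hA β β γ hγ hγ'

/-- A set of `r`-local formulas in the variables `0,…,n-1` which, up to equivalence, is closed
under negation, disjunction and the passage to the components of Feferman-Vaught decompositions. -/
structure IsLocalFVClass (L : WLogic.{u} σ W) (n r : ℕ) (Φ : Set L.Formula) : Prop where
  free_subset : ∀ φ ∈ Φ, L.free φ ⊆ Finset.range n
  isLocal : ∀ φ ∈ Φ, L.IsLocal r φ
  fv : ∀ φ ∈ Φ, ∀ Z Z' : Finset ℕ, Z.Nonempty → Z'.Nonempty → Disjoint Z Z' →
    Z ∪ Z' = L.free φ → ∃ Δ, L.IsFVDecomposition Φ φ Z Z' Δ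
  neg : ∀ φ ∈ Φ, ∃ ψ ∈ Φ, ∀ {V : Type} [Finite V] (A : WStr σ W V), A.IsWeighted →
    ∀ β : ℕ → V, L.Sat A β ψ ↔ ¬ L.Sat A β φ
  or : ∀ φ₁ ∈ Φ, ∀ φ₂ ∈ Φ, ∃ ψ ∈ Φ, ∀ {V : Type} [Finite V] (A : WStr σ W V),
    A.IsWeighted → ∀ β : ℕ → V, L.Sat A β ψ ↔ (L.Sat A β φ₁ ∨ L.Sat A β φ₂)

namespace IsLocalFVClass

variable {n : ℕ} {Φ : Set L.Formula}

theorem exists_true (h : L.IsLocalFVClass n r Φ) (hφ : φ ∈ Φ) :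
    ∃ ψ ∈ Φ, ∀ {V : Type} [Finite V] (A : WStr σ W V), A.IsWeighted →
      ∀ β : ℕ → V, L.Sat A β ψ := by
  obtain ⟨ψ, hψ, hneg⟩ := h.neg φ hφ
  obtain ⟨χ, hχ, hor⟩ := h.or φ hφ ψ hψ
  exact ⟨χ, hχ, fun A hA β => by rw [hor A hA, hneg A hA]; exact em _⟩

theorem exists_false (h : L.IsLocalFVClass n r Φ) (hφ : φ ∈ Φ) :
    ∃ ψ ∈ Φ, ∀ {V : Type} [Finite V] (A : WStr σ W V), A.IsWeighted →
      ∀ β : ℕ → V, ¬ L.Sat A β ψ := by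
  obtain ⟨ψ, hψ, htrue⟩ := h.exists_true hφ
  obtain ⟨χ, hχ, hneg⟩ := h.neg ψ hψ
  exact ⟨χ, hχ, fun A hA β => by rw [hneg A hA, not_not]; exact htrue A hA β⟩

theorem exists_disjunction (h : L.IsLocalFVClass n r Φ) (hφ : φ ∈ Φ) {D : Set L.Formula}
    (hD : D.Finite) (hDΦ : D ⊆ Φ) :
    ∃ ψ ∈ Φ, ∀ {V : Type} [Finite V] (A : WStr σ W V), A.IsWeighted →
      ∀ β : ℕ → V, L.Sat A β ψ ↔ ∃ χ ∈ D, L.Sat A β χ := by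
  induction D, hD using Set.Finite.induction_on with
  | empty =>
    obtain ⟨ψ, hψ, hfalse⟩ := h.exists_false hφ
    exact ⟨ψ, hψ, fun A hA β => by simp [hfalse A hA β]⟩
  | @insert χ D _ _ ih =>
    obtain ⟨ψ, hψ, hD⟩ := ih fun x hx => hDΦ (Set.mem_insert_of_mem _ hx)
    obtain ⟨ξ, hξ, hor⟩ := h.or χ (hDΦ (Set.mem_insert _ _)) ψ hψ
    exact ⟨ξ, hξ, fun A hA β => by rw [hor A hA, hD A hA]; simp⟩

theorem exists_near_component (h : L.IsLocalFVClass n r Φ) (hA : A.IsWeighted) (hφ : φ ∈ Φ)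
    (hZ : Z.Nonempty) (hZ' : Z'.Nonempty) (hdisj : Disjoint Z Z') (hunion : Z ∪ Z' = L.free φ)
    (δ : ℕ → V) :
    ∃ ψ ∈ Φ, ∀ β β' : ℕ → V, (∀ z ∈ Z, β z = β' z) → (∀ z ∈ Z', β z = δ z) →
      (∀ z ∈ Z, ∀ z' ∈ Z', ¬ A.gaifman.edist (β z) (β z') ≤ (2 * r + 1 : ℕ)) →
      (L.Sat A β φ ↔ L.Sat A β' ψ) := by
  obtain ⟨Δ, hΔ⟩ := h.fv φ hφ Z Z' hZ hZ' hdisj hunion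
  have ⟨hfin, _, hmem, _⟩ := hΔ
  -- The far components have fixed truth values, so those that fail at `δ` can be dropped.
  obtain ⟨ψ, hψ, hsat⟩ := h.exists_disjunction hφ
    (D := Prod.fst '' {p ∈ Δ | L.Sat A δ p.2}) ((hfin.subset (Set.sep_subset _ _)).image _)
    (by rintro _ ⟨p, hp, rfl⟩; exact (hmem p hp.1).1)
  refine ⟨ψ, hψ, fun β β' hnear hδ hfar => ?_⟩
  rw [hΔ.sat_iff (h.isLocal φ hφ) hA hZ hdisj hunion hfar, hsat A hA, Set.exists_mem_image]
  refine exists_congr fun p => ?_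
  rw [Set.mem_sep_iff, and_assoc]
  refine and_congr_right fun hp => ?_
  obtain ⟨_, _, hfree, hfree'⟩ := hmem p hp
  rw [and_comm, L.sat_congr A β δ p.2 fun z hz => hδ z (hfree' hz),
    L.sat_congr A β β' p.1 fun z hz => hnear z (hfree hz)]

theorem exists_eliminate_far (h : L.IsLocalFVClass n r Φ) (hA : A.IsWeighted) (hφ : φ ∈ Φ)
    (F : Finset ℕ) (δ : ℕ → V) :
    ∃ ψ ∈ Φ, ∀ β β' : ℕ → V, (∀ x ∈ L.free φ, x ∉ F → β x = β' x) → (∀ x ∈ F, β x = δ x) →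
      (∀ x ∈ L.free φ, x ∉ F → ∀ y ∈ F, ¬ A.gaifman.edist (β x) (β y) ≤ (2 * r + 1 : ℕ)) →
      (L.Sat A β φ ↔ L.Sat A β' ψ) := by
  rcases (L.free φ ∩ F).eq_empty_or_nonempty with hno_far | hfar_ne
  · rw [← Finset.disjoint_iff_inter_eq_empty, Finset.disjoint_left] at hno_far
    exact ⟨φ, hφ, fun β β' hnear _ _ =>
      L.sat_congr A β β' φ fun x hx => hnear x hx (hno_far hx)⟩
  rcases (L.free φ \ F).eq_empty_or_nonempty with hno_near | hnear_ne
  · have hsat (β) (hδ : ∀ x ∈ F, β x = δ x) : L.Sat A β φ ↔ L.Sat A δ φ :=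
      L.sat_congr A β δ φ fun x hx => hδ x (Finset.sdiff_eq_empty_iff_subset.1 hno_near hx)
    by_cases hφδ : L.Sat A δ φ
    · obtain ⟨ψ, hψ, htrue⟩ := h.exists_true hφ
      exact ⟨ψ, hψ, fun β β' _ hδ _ => iff_of_true ((hsat β hδ).2 hφδ) (htrue A hA β')⟩
    · obtain ⟨ψ, hψ, hfalse⟩ := h.exists_false hφ
      exact ⟨ψ, hψ, fun β β' _ hδ _ => iff_of_false (mt (hsat β hδ).1 hφδ) (hfalse A hA β')⟩
  · obtain ⟨ψ, hψ, hsat⟩ := h.exists_near_component hA hφ hnear_ne hfar_ne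
      (Finset.disjoint_sdiff_inter _ _) (Finset.sdiff_union_inter _ _) δ
    simp only [Finset.mem_sdiff, Finset.mem_inter, and_imp] at hsat
    exact ⟨ψ, hψ, fun β β' hnear hδ hfar => hsat β β' hnear (fun x _ hx => hδ x hx)
      fun x hx hxF y _ hyF => hfar x hx hxF y hyF⟩

end IsLocalFVClass

/-- The assignment of the values `a`, `v` to the variables `0,…,k-1,k,…,k+ℓ-1`, and of `x₀` to the
other variables. -/
def assignment {k ℓ : ℕ} (a : Fin k → V) (v : Fin ℓ → V) (x₀ : V) (x : ℕ) : V :=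
  if h : x < k + ℓ then Fin.append a v ⟨x, h⟩ else x₀

end

variable {S : WeightColl} {σ : Sig} {W : WSig S} {V : Type} {L : WLogic.{u} σ W} {k ℓ r : ℕ}

theorem assignment_left (a : Fin k → V) (v : Fin ℓ → V) (x₀ : V) (i : Fin k) :
    assignment a v x₀ i = a i :=
  (dif_pos (by omega)).trans (Fin.append_left a v i)

theorem assignment_right (a : Fin k → V) (v : Fin ℓ → V) (x₀ : V) (j : Fin ℓ) :
    assignment a v x₀ (k + j) = v j :=
  (dif_pos (by omega)).trans (Fin.append_right a v j)

theorem exists_fin_of_lt_add {x : ℕ} (hx : x < k + ℓ) :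
    (∃ i : Fin k, x = i) ∨ ∃ j : Fin ℓ, x = k + j := by
  rcases lt_or_ge x k with hlt | hge
  · exact Or.inl ⟨⟨x, hlt⟩, rfl⟩
  · exact Or.inr ⟨⟨x - k, by omega⟩, by simp [hge]⟩

theorem holds_iff_sat_assignment [Finite V] {A : WStr σ W V} {φ : L.Formula}
    (hφ : L.free φ ⊆ Finset.range (k + ℓ)) (a : Fin k → V) (v : Fin ℓ → V) (x₀ : V) :
    L.Holds A φ a v ↔ L.Sat A (assignment a v x₀) φ := by
  refine ⟨fun h => h _ (assignment_left a v x₀) (assignment_right a v x₀), fun h β ha hv => ?_⟩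
  refine (L.sat_congr A _ _ φ fun x hx => ?_).1 h
  rcases exists_fin_of_lt_add (Finset.mem_range.1 (hφ hx)) with ⟨i, rfl⟩ | ⟨j, rfl⟩
  · rw [assignment_left, ha]
  · rw [assignment_right, hv]

theorem IsLocalFVClass.exists_near_hypothesis [Finite V] {A : WStr σ W V} {Φ : Set L.Formula}
    (h : L.IsLocalFVClass (k + ℓ) r Φ) (hA : A.IsWeighted) {X : Set V} (hX : ℓ = 0 ∨ X.Nonempty)
    {φ : L.Formula} (hφ : φ ∈ Φ) (v : Fin ℓ → V) :
    ∃ ψ ∈ Φ, ∃ v' : Fin ℓ → V, (∀ j, v' j ∈ A.ball ((2 * r + 1) * ℓ) X) ∧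
      ∀ a : Fin k → V, (∀ i, a i ∈ X) → (L.Holds A φ a v ↔ L.Holds A ψ a v') := by
  classical
  rcases hX with rfl | ⟨x₀, hx₀⟩
  · exact ⟨φ, hφ, v, fun j => j.elim0, fun _ _ => Iff.rfl⟩
  obtain ⟨J, hJ, hJX, hJJ⟩ := A.exists_near_params (2 * r + 1) X v
  rw [Fintype.card_fin] at hJ
  let v' (j : Fin ℓ) : V := if j ∈ J then v j else x₀
  let F : Finset ℕ := Jᶜ.image fun j : Fin ℓ => k + (j : ℕ)
  have hF (j : Fin ℓ) : k + (j : ℕ) ∈ F ↔ j ∉ J := by simp [F, Fin.val_inj]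
  obtain ⟨ψ, hψ, hsat⟩ := h.exists_eliminate_far hA hφ F (assignment (fun _ : Fin k => x₀) v x₀)
  refine ⟨ψ, hψ, v', fun j => ?_, fun a ha => ?_⟩
  · by_cases hj : j ∈ J
    · simpa [v', hj] using hJ j hj
    · simpa [v', hj] using A.subset_ball _ X hx₀
  rw [holds_iff_sat_assignment (h.free_subset φ hφ) a v x₀,
    holds_iff_sat_assignment (h.free_subset ψ hψ) a v' x₀]
  have hcases (x) (hx : x ∈ L.free φ) := exists_fin_of_lt_add (Finset.mem_range.1
    (h.free_subset φ hφ hx))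
  refine hsat _ _ (fun x hx hxF => ?_) (Finset.forall_mem_image.2 fun j _ => ?_)
    fun x hx hxF => Finset.forall_mem_image.2 fun j hj => ?_
  · rcases hcases x hx with ⟨i, rfl⟩ | ⟨j, rfl⟩
    · rw [assignment_left, assignment_left]
    · rw [assignment_right, assignment_right]
      exact (if_pos (not_not.1 (mt (hF j).2 hxF))).symm
  · rw [assignment_right, assignment_right]
  · rw [Finset.mem_compl] at hj
    rw [assignment_right]
    rcases hcases x hx with ⟨i, rfl⟩ | ⟨i, rfl⟩
    · rw [assignment_left]
      exact hJX j hj _ (ha i)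
    · rw [assignment_right]
      exact hJJ j hj i (not_not.1 (mt (hF i).2 hxF))

end WLogic

/-! ### Programs with time bounds -/

section Programs

variable {S : WeightColl} {σ : Sig} {W : WSig S} {P : PredColl S} {V : Type} {A : WStr σ W V}

/-- In the store `s`, the expression `e` has the value `y`, and its evaluation takes time at most
`B`. -/
def PExp.EvalsIn (e : PExp σ W P) (acc : A.Access) (s : ℕ → Val S V) (y : Val S V) (B : ℕ) :
    Prop :=
  e.val acc s = y ∧ e.cost acc s ≤ B

/-- Started in the store `s`, the program `c` halts within time `B` in the store `s'`. -/
def ExecIn (acc : A.Access) (c : Prog σ W P) (s s' : ℕ → Val S V) (B : ℕ) : Prop :=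
  ∃ t ≤ B, Exec acc c s s' t

/-- On input `x`, the program `c` halts within time `B` with output `y`. -/
def Prog.RunsIn (c : Prog σ W P) (acc : A.Access) (x y : Val S V) (B : ℕ) : Prop :=
  ∃ t ≤ B, c.Runs acc x y t

/-- On input `x`, the program `c` halts within time `B`, and its output has the truth value `b`. -/
def Prog.DecidesIn (c : Prog σ W P) (acc : A.Access) (x : Val S V) (b : Bool) (B : ℕ) : Prop :=
  ∃ y, c.RunsIn acc x y B ∧ (y ≠ .nil ↔ b = true)

variable {acc : A.Access} {s s' s'' : ℕ → Val S V} {B B' : ℕ}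

namespace PExp.EvalsIn

variable {e e' : PExp σ W P} {x y : Val S V}

theorem mono (h : e.EvalsIn acc s y B) (hB : B ≤ B') : e.EvalsIn acc s y B' :=
  ⟨h.1, h.2.trans hB⟩

theorem var {n : ℕ} (h : s n = y) : (PExp.var n : PExp σ W P).EvalsIn acc s y 1 :=
  ⟨h, le_rfl⟩

theorem nil : (PExp.nil : PExp σ W P).EvalsIn acc s .nil 1 :=
  ⟨rfl, le_rfl⟩

theorem cons (h : e.EvalsIn acc s x B) (h' : e'.EvalsIn acc s y B') :
    (PExp.cons e e').EvalsIn acc s (.cons x y) (B + B' + 1) :=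
  ⟨congrArg₂ Val.cons h.1 h'.1, Nat.add_le_add_right (Nat.add_le_add h.2 h'.2) 1⟩

theorem hd (h : e.EvalsIn acc s (.cons x y) B) : (PExp.hd e).EvalsIn acc s x (B + 1) :=
  ⟨congrArg Val.hd h.1, Nat.add_le_add_right h.2 1⟩

theorem tl (h : e.EvalsIn acc s (.cons x y) B) : (PExp.tl e).EvalsIn acc s y (B + 1) :=
  ⟨congrArg Val.tl h.1, Nat.add_le_add_right h.2 1⟩

end PExp.EvalsIn

@[simp]
theorem initStore_zero (x : Val S V) : initStore x 0 = x :=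
  Function.update_self ..

section Rules

variable {c c' : Prog σ W P} {e : PExp σ W P} {x y : Val S V}

theorem ExecIn.mono (h : ExecIn acc c s s' B) (hB : B ≤ B') : ExecIn acc c s s' B' :=
  let ⟨t, ht, h⟩ := h
  ⟨t, ht.trans hB, h⟩

theorem ExecIn.assign (n : ℕ) (he : e.EvalsIn acc s y B) :
    ExecIn acc (.assign n e) s (Function.update s n y) (B + 1) :=
  ⟨_, Nat.add_le_add_right he.2 1, he.1 ▸ Exec.assign n e s⟩

theorem ExecIn.seq (h : ExecIn acc c s s' B) (h' : ExecIn acc c' s' s'' B') :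
    ExecIn acc (.seq c c') s s'' (B + B') :=
  let ⟨_, ht, h⟩ := h
  let ⟨_, ht', h'⟩ := h'
  ⟨_, Nat.add_le_add ht ht', h.seq h'⟩

theorem ExecIn.ite {b : Bool} (he : e.EvalsIn acc s y B) (hb : y ≠ .nil ↔ b = true)
    (h : b = true → ExecIn acc c s s' B') (h' : b = false → ExecIn acc c' s s' B') :
    ExecIn acc (.ite e c c') s s' (B + 1 + B') := by
  cases b with
  | false =>
    obtain ⟨t, ht, h'⟩ := h' rfl
    exact ⟨_, Nat.add_le_add (Nat.add_le_add_right he.2 1) ht,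
      .ite_false (he.1.trans (by simpa using hb)) h'⟩
  | true =>
    obtain ⟨t, ht, h⟩ := h rfl
    exact ⟨_, Nat.add_le_add (Nat.add_le_add_right he.2 1) ht,
      .ite_true (he.1.trans_ne (hb.2 rfl)) h⟩

theorem ExecIn.loop_done (he : e.EvalsIn acc s .nil B) : ExecIn acc (.loop e c) s s (B + 1) :=
  ⟨_, Nat.add_le_add_right he.2 1, .loop_done he.1⟩

theorem ExecIn.loop_step {B'' : ℕ} (he : e.EvalsIn acc s y B) (hy : y ≠ .nil)
    (h : ExecIn acc c s s' B') (h' : ExecIn acc (.loop e c) s' s'' B'') :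
    ExecIn acc (.loop e c) s s'' (B + 1 + B' + B'') :=
  let ⟨_, ht, h⟩ := h
  let ⟨_, ht', h'⟩ := h'
  ⟨_, Nat.add_le_add (Nat.add_le_add (Nat.add_le_add_right he.2 1) ht) ht',
    .loop_step (he.1.trans_ne hy) h h'⟩

theorem ExecIn.call (n : ℕ) (he : e.EvalsIn acc s x B) (h : c.RunsIn acc x y B') :
    ExecIn acc (.call n c e) s (Function.update s n y) (B + 1 + B') := by
  obtain ⟨rfl, he⟩ := he
  obtain ⟨t, ht, s', h, rfl⟩ := h
  exact ⟨_, Nat.add_le_add (Nat.add_le_add_right he 1) ht, .call h⟩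

theorem ExecIn.runsIn (h : ExecIn acc c (initStore x) s' B) (hy : s' 0 = y) :
    c.RunsIn acc x y B :=
  let ⟨t, ht, h⟩ := h
  ⟨t, ht, s', h, hy⟩

theorem Prog.RunsIn.mono (h : c.RunsIn acc x y B) (hB : B ≤ B') : c.RunsIn acc x y B' :=
  let ⟨t, ht, h⟩ := h
  ⟨t, ht.trans hB, h⟩

end Rules

/-! ### Folding over lists -/

/-- The list `l` as a value, with its members encoded by `enc`. -/
def Val.list {α : Type*} (enc : α → Val S V) (l : List α) : Val S V :=
  .ofList (l.map enc)

/-- The input of a fold (environment, initial value, list) or of a step of a fold (environment,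
accumulator, item). -/
def Val.triple (env acc item : Val S V) : Val S V :=
  .cons env (.cons acc item)

namespace PExp

/-- The expression that assembles the input of a fold. -/
def triple (e₁ e₂ e₃ : PExp σ W P) : PExp σ W P := .cons e₁ (.cons e₂ e₃)

/-- The environment of a fold, in a step of the fold. -/
def foldEnv : PExp σ W P := .hd (.var 0)

/-- The accumulator of a fold, in a step of the fold. -/
def foldAcc : PExp σ W P := .hd (.tl (.var 0))

/-- The current item of a fold, in a step of the fold. -/
def foldItem : PExp σ W P := .tl (.tl (.var 0))

theorem EvalsIn.triple {e₁ e₂ e₃ : PExp σ W P} {x y z : Val S V} {B₁ B₂ B₃ : ℕ}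
    (h₁ : e₁.EvalsIn acc s x B₁) (h₂ : e₂.EvalsIn acc s y B₂) (h₃ : e₃.EvalsIn acc s z B₃) :
    (PExp.triple e₁ e₂ e₃).EvalsIn acc s (.triple x y z) (B₁ + (B₂ + B₃ + 1) + 1) :=
  h₁.cons (h₂.cons h₃)

variable {x y z : Val S V}

theorem foldEnv_evalsIn (h : s 0 = .triple x y z) :
    (foldEnv : PExp σ W P).EvalsIn acc s x 2 :=
  (EvalsIn.var h).hd

theorem foldAcc_evalsIn (h : s 0 = .triple x y z) :
    (foldAcc : PExp σ W P).EvalsIn acc s y 3 :=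
  (EvalsIn.var h).tl.hd

theorem foldItem_evalsIn (h : s 0 = .triple x y z) :
    (foldItem : PExp σ W P).EvalsIn acc s z 3 :=
  (EvalsIn.var h).tl.tl

end PExp

open PExp (foldEnv foldAcc foldItem foldEnv_evalsIn foldAcc_evalsIn foldItem_evalsIn)

namespace Prog

/-- The loop of `Prog.fold`: the accumulator is kept in variable `1`, the rest of the list in
variable `2`. -/
def foldLoop (c : Prog σ W P) : Prog σ W P :=
  .loop (.var 2) <| .seq (.call 1 c (.triple (.hd (.var 0)) (.var 1) (.hd (.var 2))))
    (.assign 2 (.tl (.var 2)))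

/-- Folds a list from the left by the program `c`. -/
def fold (c : Prog σ W P) : Prog σ W P :=
  .seq (.assign 1 foldAcc) <| .seq (.assign 2 foldItem) <| .seq c.foldLoop (.assign 0 (.var 1))

section Fold

variable {α β : Type*} {env : Val S V} {encA : α → Val S V} {encB : β → Val S V}
  {f : β → α → β} {c : Prog σ W P} {l : List α}

theorem foldLoop_execIn {x : Val S V} {b : β} (hc : ∀ b, ∀ a ∈ l,
      c.RunsIn acc (.triple env (encB b) (encA a)) (encB (f b a)) B)
    (h0 : s 0 = .cons env x) (h1 : s 1 = encB b) (h2 : s 2 = .list encA l) :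
    ∃ s', s' 1 = encB (l.foldl f b) ∧ ExecIn acc c.foldLoop s s' (2 + l.length * (B + 13)) := by
  induction l generalizing b s with
  | nil => exact ⟨s, h1, (ExecIn.loop_done (PExp.EvalsIn.var h2)).mono (by simp)⟩
  | cons a l ih =>
    replace h2 : s 2 = .cons (encA a) (.list encA l) := h2
    have hbody := (ExecIn.call 1
      ((PExp.EvalsIn.var h0).hd.triple (.var h1) (PExp.EvalsIn.var h2).hd)
      (hc b a List.mem_cons_self)).seq
      (ExecIn.assign 2
        (PExp.EvalsIn.var (n := 2) (y := .cons (encA a) (.list encA l)) (by simpa using h2)).tl)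
    obtain ⟨s', hs', hrest⟩ := ih (fun b a ha => hc b a (List.mem_cons_of_mem _ ha))
      (b := f b a) (s := Function.update (Function.update s 1 (encB (f b a))) 2 (.list encA l))
      (by simpa using h0) (by simp) (by simp)
    refine ⟨s', hs', (ExecIn.loop_step (.var h2) (by simp) hbody hrest).mono ?_⟩
    rw [List.length_cons, add_one_mul l.length]
    omega

theorem fold_runsIn (hc : ∀ b, ∀ a ∈ l,
      c.RunsIn acc (.triple env (encB b) (encA a)) (encB (f b a)) B) (b : β) :
    c.fold.RunsIn acc (.triple env (encB b) (.list encA l)) (encB (l.foldl f b))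
      (12 + l.length * (B + 13)) := by
  set x : Val S V := .triple env (encB b) (.list encA l) with hx
  obtain ⟨s', hs', hloop⟩ := foldLoop_execIn (b := b) hc (x := .cons (encB b) (.list encA l))
    (s := Function.update (Function.update (initStore x) 1 (encB b)) 2 (.list encA l))
    (by simp [hx, Val.triple]) (by simp) (by simp)
  refine (((ExecIn.assign 1 (foldAcc_evalsIn (initStore_zero x))).seq
    ((ExecIn.assign 2 (foldItem_evalsIn (x := env) (y := encB b) (by simp [hx]))).seq
    (hloop.seq (ExecIn.assign 0 (.var hs'))))).mono ?_).runsIn (by simp)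
  omega

end Fold

/-- Evaluates the expression `g` for every item of a list and pushes the values onto the
accumulator. -/
def mapOnto (g : PExp σ W P) : Prog σ W P :=
  fold (.assign 0 (.cons g foldAcc))

/-- For every item of a list, evaluates `e₁` and `e₂` and maps `g` over the list `e₂` in the
environment `e₁`; collects all the values. -/
def flatMap (g e₁ e₂ : PExp σ W P) : Prog σ W P :=
  fold (.call 0 (mapOnto g) (.triple e₁ foldAcc e₂))

section FlatMap

variable {α β γ : Type*} {encA : α → Val S V} {encB : β → Val S V} {encC : γ → Val S V}
  {g e₁ e₂ : PExp σ W P} {l : List α} {G E₁ E₂ : ℕ}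

theorem mapOnto_runsIn {env : Val S V} {f : α → β}
    (hg : ∀ a ∈ l, ∀ y, g.EvalsIn acc (initStore (.triple env y (encA a))) (encB (f a)) G)
    (m : List β) :
    (mapOnto g).RunsIn acc (.triple env (.list encB m) (.list encA l))
      (.list encB ((l.map f).reverse ++ m)) (12 + l.length * (G + 18)) := by
  rw [← List.foldl_flip_cons_eq_append]
  refine (fold_runsIn (B := G + 5) ?_ m).mono (by rw [Nat.add_assoc G 5 13])
  intro m a ha
  exact (ExecIn.assign 0 ((hg a ha _).cons (foldAcc_evalsIn (initStore_zero _)))).runsIn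
    (by simp [Val.list, Val.ofList])

theorem flatMap_runsIn {env : Val S V} {env' : α → Val S V} {m : α → List γ} {f : α → γ → β}
    {K : ℕ} (hK : ∀ a ∈ l, (m a).length ≤ K)
    (h₁ : ∀ a ∈ l, ∀ y, e₁.EvalsIn acc (initStore (.triple env y (encA a))) (env' a) E₁)
    (h₂ : ∀ a ∈ l, ∀ y,
      e₂.EvalsIn acc (initStore (.triple env y (encA a))) (.list encC (m a)) E₂)
    (hg : ∀ a ∈ l, ∀ x ∈ m a, ∀ y,
      g.EvalsIn acc (initStore (.triple (env' a) y (encC x))) (encB (f a x)) G) :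
    (flatMap g e₁ e₂).RunsIn acc (.triple env .nil (.list encA l))
      (.list encB (l.flatMap fun a => (m a).map (f a)).reverse)
      (12 + l.length * (E₁ + E₂ + 31 + K * (G + 18))) := by
  have hfold : (l.flatMap fun a => (m a).map (f a)).reverse =
      l.foldl (fun ys a => ((m a).map (f a)).reverse ++ ys) [] := by
    rw [List.foldl_flip_append_eq_append, List.append_nil, ← List.map_reverse,
      List.reverse_flatMap, List.flatMap]
    rfl
  rw [hfold]
  refine (fold_runsIn (encB := Val.list encB) (B := E₁ + E₂ + 18 + K * (G + 18)) ?_ []).mono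
    (by ring_nf; rfl)
  intro ys a ha
  refine ((ExecIn.call 0 ((h₁ a ha _).triple (foldAcc_evalsIn (initStore_zero _)) (h₂ a ha _))
    (mapOnto_runsIn (hg a ha) ys)).mono ?_).runsIn (by simp)
  have := Nat.mul_le_mul_right (G + 18) (hK a ha)
  omega

end FlatMap

/-- Stores the value of `e₀` in the variable `x` and then, for all members `i` of a list from the
last to the first, the output of `c i` on the value of `e`. -/
def chain {ι : Type*} (x : ℕ) (e₀ e : PExp σ W P) (c : ι → Prog σ W P) : List ι → Prog σ W P
  | [] => .assign x e₀
  | i :: is => .seq (chain x e₀ e c is) (.call x (c i) e)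

theorem chain_execIn {ι : Type*} {x : ℕ} {e₀ e : PExp σ W P} {c : ι → Prog σ W P} {is : List ι}
    {E₀ E : ℕ} (y z : List ι → Val S V) (h₀ : e₀.EvalsIn acc s (y []) E₀)
    (he : ∀ i is', i :: is' <:+ is → e.EvalsIn acc (Function.update s x (y is')) (z is') E)
    (hc : ∀ i is', i :: is' <:+ is → (c i).RunsIn acc (z is') (y (i :: is')) B) :
    ExecIn acc (chain x e₀ e c is) s (Function.update s x (y is))
      (E₀ + 1 + is.length * (E + 1 + B)) := by
  induction is with
  | nil => exact (ExecIn.assign x h₀).mono (Nat.le_add_right _ _)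
  | cons i is ih =>
    have hstep := (ih (fun j is' h => he j is' (h.trans (List.suffix_cons i is)))
      (fun j is' h => hc j is' (h.trans (List.suffix_cons i is)))).seq
      (ExecIn.call x (he i is List.suffix_rfl) (hc i is List.suffix_rfl))
    rw [Function.update_idem] at hstep
    refine hstep.mono (le_of_eq ?_)
    rw [List.length_cons, add_one_mul is.length, add_assoc]

/-- Stores the value of `e₀` in the variable `x` and then, `n` times, the output of `c` on the value
of `e`. -/
def iterate (x : ℕ) (e₀ e : PExp σ W P) (c : Prog σ W P) (n : ℕ) : Prog σ W P :=
  chain x e₀ e (fun _ => c) (List.replicate n ())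

theorem iterate_execIn {x n : ℕ} {e₀ e : PExp σ W P} {c : Prog σ W P} {E₀ E : ℕ}
    (y z : ℕ → Val S V) (h₀ : e₀.EvalsIn acc s (y 0) E₀)
    (he : ∀ j < n, e.EvalsIn acc (Function.update s x (y j)) (z j) E)
    (hc : ∀ j < n, c.RunsIn acc (z j) (y (j + 1)) B) :
    ExecIn acc (iterate x e₀ e c n) s (Function.update s x (y n)) (E₀ + 1 + n * (E + 1 + B)) := by
  have hlt {i : Unit} {is : List Unit} (h : i :: is <:+ List.replicate n ()) : is.length < n := by
    simpa using h.length_le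
  simpa [iterate] using chain_execIn (is := List.replicate n ()) (fun is => y is.length)
    (fun is => z is.length) h₀ (fun _ is h => he _ (hlt h)) (fun _ is h => hc _ (hlt h))

end Prog

end Programs

/-! ### Collecting the candidate parameters -/

section Candidates

variable {S : WeightColl} {σ : Sig} {W : WSig S} {P : PredColl S} {V : Type} {A : WStr σ W V}
  {acc : A.Access}

open PExp (foldEnv foldItem foldEnv_evalsIn foldItem_evalsIn)

theorem PExp.EvalsIn.nbrs {s : ℕ → Val S V} {e : PExp σ W P} {a : V} {B : ℕ}
    (h : e.EvalsIn acc s (.elem a) B) :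
    (PExp.nbrs e).EvalsIn acc s (.list .elem (acc.nbrs a))
      (B + 1 + ((acc.nbrs a).length + 1) * nameLen V) := by
  refine ⟨by simp only [PExp.val, h.1, Val.list], ?_⟩
  simpa only [PExp.cost, h.1] using Nat.add_le_add_right (Nat.add_le_add_right h.2 1) _

theorem Val.tuple_eq_list {n : ℕ} (a : Fin n → V) :
    (Val.tuple a : Val S V) = .list .elem (List.ofFn a) := by
  rw [Val.tuple, Val.list, List.map_ofFn]
  rfl

theorem Val.tuple_cons {n : ℕ} (x : V) (a : Fin n → V) :
    (Val.tuple (Fin.cons x a : Fin (n + 1) → V) : Val S V) = .cons (.elem x) (Val.tuple a) := by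
  simp [Val.tuple, List.ofFn_succ, Val.ofList]

theorem length_flatMap_le {α β : Type*} {f : α → List β} {l : List α} {K : ℕ}
    (h : ∀ a ∈ l, (f a).length ≤ K) : (l.flatMap f).length ≤ l.length * K := by
  rw [List.length_flatMap]
  simpa using List.sum_le_card_nsmul (l.map fun a => (f a).length) K (by simpa using h)

theorem WStr.Access.length_nbrs_le [Finite V] (acc : A.Access) (a : V) :
    (acc.nbrs a).length ≤ A.degree := by
  classical
  have hcard : (A.gaifman.neighborSet a).ncard = (acc.nbrs a).length := by
    rw [← List.toFinset_card_of_nodup (acc.nodup a), ← Set.ncard_coe_finset]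
    congr 1
    ext b
    simp [acc.mem_nbrs]
  rw [← hcard]
  exact le_ciSup (f := fun v => (A.gaifman.neighborSet v).ncard) (Set.finite_range _).bddAbove a

/-- The elements of a training sequence, in the order in which `Prog.collect` lists them. -/
def collectList {k : ℕ} (T : List ((Fin k → V) × Bool)) : List V :=
  (T.flatMap fun p => List.ofFn p.1).reverse

theorem mem_collectList {k : ℕ} {T : List ((Fin k → V) × Bool)} {a : V} :
    a ∈ collectList T ↔ a ∈ trainingElems T := by
  simp only [collectList, List.mem_reverse, List.mem_flatMap, List.mem_ofFn, trainingElems,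
    Set.mem_ofPred_eq]

theorem length_collectList_le {k : ℕ} (T : List ((Fin k → V) × Bool)) :
    (collectList T).length ≤ T.length * k := by
  rw [collectList, List.length_reverse]
  exact length_flatMap_le fun p _ => (List.length_ofFn).le

/-- Lists the elements of a training sequence. -/
def Prog.collect : Prog σ W P :=
  flatMap foldItem .nil (.hd foldItem)

theorem Prog.collect_runsIn {k : ℕ} (T : List ((Fin k → V) × Bool)) :
    (collect : Prog σ W P).RunsIn acc (.triple .nil .nil (Val.training T))
      (.list .elem (collectList T)) (12 + T.length * (36 + k * 21)) := by
  have h₂ (p : (Fin k → V) × Bool) (y : Val S V) : (PExp.hd foldItem : PExp σ W P).EvalsIn acc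
      (initStore (.triple .nil y (.cons (Val.tuple p.1) (Val.bool p.2))))
      (.list .elem (List.ofFn p.1)) 4 := by
    rw [← Val.tuple_eq_list]
    exact (foldItem_evalsIn (initStore_zero _)).hd
  have h := flatMap_runsIn (f := fun _ a => a) (G := 3) (fun p _ => (List.length_ofFn).le)
    (fun _ _ _ => .nil) (fun p (_ : p ∈ T) y => h₂ p y)
    (fun _ _ _ _ _ => foldItem_evalsIn (initStore_zero _))
  simp only [List.map_id'] at h
  exact h

/-- The elements of a list and their neighbours, in the order in which `Prog.expand` lists them. -/
def expandList (acc : A.Access) (l : List V) : List V :=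
  (l.flatMap fun a => a :: acc.nbrs a).reverse

theorem mem_iterate_expandList {l : List V} {n : ℕ} {b : V} :
    b ∈ (expandList acc)^[n] l ↔ b ∈ A.ball n {a | a ∈ l} := by
  induction n generalizing b with
  | zero => rw [WStr.ball_zero]; rfl
  | succ n ih =>
    simp only [Function.iterate_succ_apply', expandList, List.mem_reverse, List.mem_flatMap,
      List.mem_cons, acc.mem_nbrs, WStr.mem_ball_succ, ih, and_or_left, exists_or,
      exists_eq_right']

theorem length_iterate_expandList_le [Finite V] (acc : A.Access) (l : List V) (n : ℕ) :
    ((expandList acc)^[n] l).length ≤ l.length * (A.degree + 1) ^ n := by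
  induction n with
  | zero => simp
  | succ n ih =>
    rw [Function.iterate_succ_apply', pow_succ, ← mul_assoc, expandList, List.length_reverse]
    exact (length_flatMap_le fun a _ => Nat.succ_le_succ (acc.length_nbrs_le a)).trans
      (Nat.mul_le_mul_right _ ih)

/-- Lists the elements of a list and their neighbours. -/
def Prog.expand : Prog σ W P :=
  flatMap foldItem .nil (.cons foldItem (.nbrs foldItem))

theorem Prog.expand_runsIn [Finite V] (l : List V) :
    (expand : Prog σ W P).RunsIn acc (.triple .nil .nil (.list .elem l))
      (.list .elem (expandList acc l))
      (12 + l.length * (40 + (A.degree + 1) * nameLen V + (A.degree + 1) * 21)) := by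
  have h₂ (a : V) (y : Val S V) : (PExp.cons foldItem (.nbrs foldItem) : PExp σ W P).EvalsIn acc
      (initStore (.triple .nil y (.elem a))) (.list .elem (a :: acc.nbrs a))
      (8 + (A.degree + 1) * nameLen V) := by
    have ha := foldItem_evalsIn (acc := acc) (P := P) (initStore_zero (.triple .nil y (.elem a)))
    refine (ha.cons ha.nbrs).mono ?_
    have := Nat.mul_le_mul_right (nameLen V) (Nat.add_le_add_right (acc.length_nbrs_le a) 1)
    omega
  have h := flatMap_runsIn (f := fun _ b => b) (G := 3)
    (fun a _ => Nat.add_le_add_right (acc.length_nbrs_le a) 1) (fun _ _ _ => .nil)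
    (fun a (_ : a ∈ l) y => h₂ a y) (fun _ _ _ _ _ => foldItem_evalsIn (initStore_zero _))
  simp only [List.map_id'] at h
  exact h.mono (Nat.le_of_eq (by ring))

/-- Replaces the list of elements in variable `1` by a list of its `R`-neighbourhood. -/
def Prog.expandIter (R : ℕ) : Prog σ W P :=
  iterate 1 (.var 1) (.triple .nil .nil (.var 1)) expand R

theorem Prog.expandIter_execIn [Finite V] {l : List V} {s : ℕ → Val S V} {R K : ℕ}
    (hs : s 1 = .list .elem l) (hK : l.length * (A.degree + 1) ^ R ≤ K) :
    ExecIn acc (expandIter R : Prog σ W P) s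
      (Function.update s 1 (.list .elem ((expandList acc)^[R] l)))
      (2 + R * (18 + K * (40 + (A.degree + 1) * nameLen V + (A.degree + 1) * 21))) := by
  have hlen {j : ℕ} (hj : j < R) : ((expandList acc)^[j] l).length ≤ K :=
    (length_iterate_expandList_le acc l j).trans
      (le_trans (by gcongr; exact Nat.le_add_left 1 _) hK)
  refine (iterate_execIn (E₀ := 1) (E := 5)
    (B := 12 + K * (40 + (A.degree + 1) * nameLen V + (A.degree + 1) * 21))
    (fun j => .list .elem ((expandList acc)^[j] l))
    (fun j => .triple .nil .nil (.list .elem ((expandList acc)^[j] l)))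
    (.var hs) (fun j _ => .triple .nil .nil (.var (by simp))) fun j hj => ?_).mono
      (Nat.le_of_eq (by ring))
  rw [Function.iterate_succ_apply']
  exact (expand_runsIn _).mono (by gcongr; exact hlen hj)

/-- The `j`-tuples over a list, in the order in which `Prog.tuplesIter` lists them. -/
def tuplesList (l : List V) : (j : ℕ) → List (Fin j → V)
  | 0 => [Fin.elim0]
  | j + 1 => (l.flatMap fun a => (tuplesList l j).map (Fin.cons a)).reverse

theorem mem_tuplesList {l : List V} {j : ℕ} {v : Fin j → V} :
    v ∈ tuplesList l j ↔ ∀ i, v i ∈ l := by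
  induction j with
  | zero => simpa [tuplesList] using Subsingleton.elim _ _
  | succ j ih =>
    simp only [tuplesList, List.mem_reverse, List.mem_flatMap, List.mem_map, ih]
    constructor
    · rintro ⟨a, ha, u, hu, rfl⟩
      exact Fin.cases ha hu
    · intro h
      exact ⟨v 0, h 0, Fin.tail v, fun i => h i.succ, Fin.cons_self_tail v⟩

theorem length_tuplesList_le (l : List V) (j : ℕ) : (tuplesList l j).length ≤ l.length ^ j := by
  induction j with
  | zero => simp [tuplesList]
  | succ j ih =>
    rw [tuplesList, List.length_reverse, pow_succ']
    exact length_flatMap_le fun a _ => (List.length_map _).trans_le ih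

/-- Prefixes each tuple of a list by each element of a list. -/
def Prog.extendTuples : Prog σ W P :=
  flatMap (.cons foldEnv foldItem) foldItem foldEnv

theorem Prog.extendTuples_runsIn (l : List V) (j : ℕ) :
    (extendTuples : Prog σ W P).RunsIn acc
      (.triple (.list Val.tuple (tuplesList l j)) .nil (.list .elem l))
      (.list Val.tuple (tuplesList l (j + 1)))
      (12 + l.length * (36 + (tuplesList l j).length * 24)) :=
  flatMap_runsIn (f := fun a v => (Fin.cons a v : Fin (j + 1) → V)) (G := 6)
    (env' := fun a => .elem a) (fun _ _ => le_rfl)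
    (fun _ _ _ => foldItem_evalsIn (initStore_zero _))
    (fun _ _ _ => foldEnv_evalsIn (initStore_zero _)) fun a _ v _ _ => by
    rw [Val.tuple_cons]
    exact (foldEnv_evalsIn (initStore_zero _)).cons (foldItem_evalsIn (initStore_zero _))

/-- Stores a list of the `ℓ`-tuples over the list in variable `1` in variable `2`. -/
def Prog.tuplesIter (ℓ : ℕ) : Prog σ W P :=
  iterate 2 (.cons .nil .nil) (.triple (.var 2) .nil (.var 1)) extendTuples ℓ

theorem Prog.tuplesIter_execIn {l : List V} {s : ℕ → Val S V} {ℓ K M : ℕ}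
    (hs : s 1 = .list .elem l) (hK : l.length ≤ K) (hM : ∀ j < ℓ, (tuplesList l j).length ≤ M) :
    ExecIn acc (tuplesIter ℓ : Prog σ W P) s
      (Function.update s 2 (.list Val.tuple (tuplesList l ℓ)))
      (4 + ℓ * (18 + K * (36 + M * 24))) := by
  refine (iterate_execIn (E₀ := 3) (E := 5) (B := 12 + K * (36 + M * 24))
    (fun j => .list Val.tuple (tuplesList l j))
    (fun j => .triple (.list Val.tuple (tuplesList l j)) .nil (.list .elem l)) ?_
    (fun j _ => .triple (.var (by simp)) .nil (.var (by simpa using hs))) fun j hj => ?_).mono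
      (Nat.le_of_eq (by ring))
  · exact .cons .nil .nil
  · exact (extendTuples_runsIn l j).mono (by gcongr; exact hM j hj)

end Candidates

/-! ### Searching a consistent hypothesis -/

section Search

variable {S : WeightColl} {σ : Sig} {W : WSig S} {P : PredColl S} {V : Type} {A : WStr σ W V}
  {acc : A.Access} {s : ℕ → Val S V} {B : ℕ} {c : Prog σ W P} {k ℓ N : ℕ}

open PExp (foldEnv foldAcc foldItem foldEnv_evalsIn foldAcc_evalsIn foldItem_evalsIn)

theorem Val.bool_ne_nil {b : Bool} : (Val.bool b : Val S V) ≠ .nil ↔ b = true := by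
  cases b <;> simp [Val.bool]

theorem ExecIn.ite_assign {e e₁ e₂ : PExp σ W P} {b : Bool} {y y₁ y₂ : Val S V} {E E' n : ℕ}
    (he : e.EvalsIn acc s y E) (hb : y ≠ .nil ↔ b = true) (h₁ : e₁.EvalsIn acc s y₁ E')
    (h₂ : e₂.EvalsIn acc s y₂ E') :
    ExecIn acc (.ite e (.assign n e₁) (.assign n e₂)) s
      (Function.update s n (if b then y₁ else y₂)) (E + 1 + (E' + 1)) :=
  .ite he hb (fun hb => if_pos hb ▸ .assign n h₁)
    (fun hb => if_neg (Bool.eq_false_iff.1 hb) ▸ .assign n h₂)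

namespace PExp

/-- The concatenation of a list of length `n` and another list. -/
def append : ℕ → PExp σ W P → PExp σ W P → PExp σ W P
  | 0, _, e' => e'
  | n + 1, e, e' => .cons (.hd e) (append n (.tl e) e')

theorem append_evalsIn {e e' : PExp σ W P} {l l' : List (Val S V)} {E E' : ℕ}
    (he : e.EvalsIn acc s (.ofList l) E) (he' : e'.EvalsIn acc s (.ofList l') E') :
    (append l.length e e').EvalsIn acc s (.ofList (l ++ l'))
      (l.length * (E + l.length + 2) + E') := by
  induction l generalizing e E with
  | nil => exact he'.mono (Nat.le_add_left _ _)
  | cons x l ih =>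
    have h := he.hd.cons (ih he.tl)
    refine h.mono ?_
    rw [List.length_cons]
    nlinarith

theorem append_tuple_evalsIn {e e' : PExp σ W P} {a : Fin k → V} {v : Fin ℓ → V} {E E' : ℕ}
    (he : e.EvalsIn acc s (.tuple a) E) (he' : e'.EvalsIn acc s (.tuple v) E') :
    (append k e e').EvalsIn acc s (.tuple (Fin.append a v)) (k * (E + k + 2) + E') := by
  have h := append_evalsIn he he'
  rw [List.length_ofFn] at h
  rwa [Val.tuple_eq_list, Val.list, List.ofFn_fin_append, List.map_append, List.map_ofFn,
    List.map_ofFn]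

/-- The unary representation of `n`. -/
def num : ℕ → PExp σ W P
  | 0 => .nil
  | n + 1 => .cons .nil (num n)

theorem num_evalsIn (n : ℕ) : (num n : PExp σ W P).EvalsIn acc s (.num n) (2 * n + 1) := by
  induction n with
  | zero => exact .nil
  | succ n ih => exact (EvalsIn.nil.cons ih).mono (by omega)

end PExp

/-- A step of `Prog.check`: compares the answer of `c` on one training example with its label. -/
def Prog.checkExample (k : ℕ) (c : Prog σ W P) : Prog σ W P :=
  .seq (.call 1 c (.append k (.hd foldItem) foldEnv)) <|
  .ite (.var 1)
    (.ite (.tl foldItem) (.assign 0 foldAcc) (.assign 0 .nil))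
    (.ite (.tl foldItem) (.assign 0 .nil) (.assign 0 foldAcc))

theorem Prog.checkExample_runsIn {a : Fin k → V} {v : Fin ℓ → V} {d : Bool}
    (hc : c.DecidesIn acc (.tuple (Fin.append a v)) d B) (b ok : Bool) :
    (checkExample k c).RunsIn acc
      (.triple (.tuple v) (.bool ok) (.cons (.tuple a) (.bool b)))
      (.bool (ok && (d == b))) (B + k * (k + 6) + 14) := by
  obtain ⟨y, hrun, hy⟩ := hc
  set x : Val S V := .triple (.tuple v) (.bool ok) (.cons (.tuple a) (.bool b)) with hx
  have h0 : initStore x 0 = x := initStore_zero x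
  have h0' : Function.update (initStore x) 1 y 0 = x := by simp
  have hlabel := (foldItem_evalsIn (acc := acc) (P := P) h0').tl
  have hacc := foldAcc_evalsIn (acc := acc) (P := P) h0'
  have hnil : (PExp.nil : PExp σ W P).EvalsIn acc (Function.update (initStore x) 1 y) .nil 3 :=
    PExp.EvalsIn.nil.mono (by norm_num)
  have hcall := ExecIn.call 1
    (PExp.append_tuple_evalsIn (foldItem_evalsIn h0).hd (foldEnv_evalsIn h0)) hrun
  have hcompare : ExecIn acc (P := P) (.ite (.var 1)
      (.ite (.tl foldItem) (.assign 0 foldAcc) (.assign 0 .nil))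
      (.ite (.tl foldItem) (.assign 0 .nil) (.assign 0 foldAcc)))
      (Function.update (initStore x) 1 y)
      (Function.update (Function.update (initStore x) 1 y) 0 (.bool (ok && (d == b)))) 11 := by
    refine ExecIn.ite (B := 1) (B' := 9) (.var (by simp)) hy ?_ ?_
    · rintro rfl
      convert ExecIn.ite_assign (n := 0) hlabel Val.bool_ne_nil hacc hnil using 2
      cases b <;> simp [Val.bool]
    · rintro rfl
      convert ExecIn.ite_assign (n := 0) hlabel Val.bool_ne_nil hnil hacc using 2
      cases b <;> simp [Val.bool]
  refine ((hcall.seq hcompare).mono ?_).runsIn (by simp)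
  have : k * (3 + 1 + k + 2) = k * (k + 6) := by ring
  omega

open Classical in
theorem foldl_and_eq_consistent (h : (Fin k → V) → Bool) (T : List ((Fin k → V) × Bool))
    (b : Bool) :
    T.foldl (fun b p => b && (h p.1 == p.2)) b = (b && decide (Consistent h T)) := by
  induction T generalizing b with
  | nil => simp [Consistent]
  | cons p T ih =>
    rw [List.foldl_cons, ih, Bool.and_assoc, Bool.eq_iff_iff]
    simp [Consistent]

/-- Decides, for a tuple `v` of parameters, whether `c` answers correctly on all training
examples. -/
def Prog.check (k : ℕ) (c : Prog σ W P) : Prog σ W P :=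
  fold (checkExample k c)

open Classical in
theorem Prog.check_runsIn {v : Fin ℓ → V} {h : (Fin k → V) → Bool}
    (hc : ∀ a, c.DecidesIn acc (.tuple (Fin.append a v)) (h a) B)
    (T : List ((Fin k → V) × Bool)) :
    (check k c).RunsIn acc (.triple (.tuple v) (.bool true) (Val.training T))
      (.bool (decide (Consistent h T))) (12 + T.length * (B + k * (k + 6) + 27)) := by
  have hfold := fold_runsIn (l := T) (fun ok p _ => checkExample_runsIn (hc p.1) p.2 ok) true
  rwa [foldl_and_eq_consistent, Bool.true_and] at hfold

/-- The output of the learner: the index of a formula and the parameters, or `nil` for a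
rejection. -/
def Val.hypothesis : Option (Fin N × (Fin ℓ → V)) → Val S V
  | none => .nil
  | some (i, v) => .cons (.num i) (.tuple v)

/-- Searches a list of tuples of parameters for one with which `c` is correct on all training
examples; such a tuple is returned together with the number `i`. -/
def Prog.search (k i : ℕ) (c : Prog σ W P) : Prog σ W P :=
  fold <| .seq (.call 1 (check k c) (.triple foldItem (.cons .nil .nil) foldEnv)) <|
    .ite (.var 1) (.assign 0 (.cons (.num i) foldItem)) (.assign 0 foldAcc)

theorem foldl_ite_some {α β : Type*} (p : α → Bool) (f : α → β) (l : List α) (o : Option β) :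
    l.foldl (fun o a => if p a then some (f a) else o) o = ((l.reverse.find? p).map f).or o := by
  induction l generalizing o with
  | nil => simp
  | cons a l ih => cases h : p a <;> simp [ih, h]

open Classical in
theorem Prog.search_runsIn (i : Fin N) {h : (Fin ℓ → V) → (Fin k → V) → Bool}
    (hc : ∀ v a, c.DecidesIn acc (.tuple (Fin.append a v)) (h v a) B)
    (T : List ((Fin k → V) × Bool)) (l : List (Fin ℓ → V)) (o : Option (Fin N × (Fin ℓ → V))) :
    (search k i c).RunsIn acc (.triple (Val.training T) (Val.hypothesis o) (.list Val.tuple l))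
      (Val.hypothesis
        (((l.reverse.find? fun v => decide (Consistent (h v) T)).map (Prod.mk i)).or o))
      (12 + l.length * (T.length * (B + k * (k + 6) + 27) + 2 * N + 50)) := by
  rw [← foldl_ite_some]
  refine (fold_runsIn (B := T.length * (B + k * (k + 6) + 27) + 2 * N + 37) ?_ o).mono le_rfl
  intro o v _
  set x : Val S V := .triple (Val.training T) (Val.hypothesis o) (Val.tuple v) with hx
  set ok : Bool := decide (Consistent (h v) T)
  have h0 : initStore x 0 = x := initStore_zero x
  have h0' : Function.update (initStore x) 1 (.bool ok) 0 = x := by simp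
  have hcall := ExecIn.call 1 ((foldItem_evalsIn h0).triple
    (y := .bool true) (.cons .nil .nil) (foldEnv_evalsIn h0)) (check_runsIn (hc v) T)
  have hupdate := ExecIn.ite_assign (acc := acc) (P := P) (E' := 2 * N + 5) (n := 0)
    (PExp.EvalsIn.var (n := 1) (y := .bool ok) (by simp)) Val.bool_ne_nil
    (((PExp.num_evalsIn i).cons (foldItem_evalsIn h0')).mono (by omega))
    ((foldAcc_evalsIn h0').mono (by omega))
  refine ((hcall.seq hupdate).mono (by omega)).runsIn ?_
  split <;> simp_all [Val.hypothesis]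

end Search

/-! ### The learner -/

section Learner

variable {S : WeightColl} {σ : Sig} {W : WSig S} {P : PredColl S} {V : Type} {A : WStr σ W V}
  {acc : A.Access} {s : ℕ → Val S V} {B k ℓ N : ℕ} {mc : Fin N → Prog σ W P}
  {h : Fin N → (Fin ℓ → V) → (Fin k → V) → Bool} {T : List ((Fin k → V) × Bool)}

open Classical in
/-- The first hypothesis `h i v` with `i ∈ is` that is consistent with `T`, where the parameters
`v` are taken from the end of `l` first, as in `Prog.search`. -/
noncomputable def searchResult (h : Fin N → (Fin ℓ → V) → (Fin k → V) → Bool)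
    (T : List ((Fin k → V) × Bool)) (l : List (Fin ℓ → V)) (is : List (Fin N)) :
    Option (Fin N × (Fin ℓ → V)) :=
  is.findSome? fun i => (l.reverse.find? fun v => decide (Consistent (h i v) T)).map (Prod.mk i)

theorem searchResult_eq_none {l : List (Fin ℓ → V)} {is : List (Fin N)} :
    searchResult h T l is = none ↔ ∀ i ∈ is, ∀ v ∈ l, ¬ Consistent (h i v) T := by
  simp [searchResult]

theorem mem_and_consistent_of_searchResult_eq_some {l : List (Fin ℓ → V)} {is : List (Fin N)}
    {i : Fin N} {v : Fin ℓ → V} (hsome : searchResult h T l is = some (i, v)) :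
    v ∈ l ∧ Consistent (h i v) T := by
  obtain ⟨j, _, hj⟩ := List.exists_of_findSome?_eq_some hsome
  obtain ⟨w, hw, heq⟩ := Option.map_eq_some_iff.1 hj
  cases heq
  exact ⟨List.mem_reverse.1 (List.mem_of_find?_eq_some hw), by simpa using List.find?_some hw⟩

/-- Runs `Prog.search` for all formulas. -/
def Prog.searchAll (k : ℕ) (mc : Fin N → Prog σ W P) : Prog σ W P :=
  chain 3 .nil (.triple (.var 0) (.var 3) (.var 2)) (fun i : Fin N => search k i (mc i))
    (List.finRange N)

theorem Prog.searchAll_execIn {l : List (Fin ℓ → V)}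
    (hc : ∀ i v a, (mc i).DecidesIn acc (.tuple (Fin.append a v)) (h i v a) B)
    (h₀ : s 0 = Val.training T) (h₂ : s 2 = .list .tuple l) :
    ExecIn acc (searchAll k mc) s
      (Function.update s 3 (Val.hypothesis (searchResult h T l (List.finRange N))))
      (2 + N * (18 + l.length * (T.length * (B + k * (k + 6) + 27) + 2 * N + 50))) := by
  refine (chain_execIn (s := s) (x := 3)
    (B := 12 + l.length * (T.length * (B + k * (k + 6) + 27) + 2 * N + 50))
    (fun is => Val.hypothesis (searchResult h T l is))
    (fun is => .triple (Val.training T) (Val.hypothesis (searchResult h T l is)) (.list .tuple l))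
    .nil (fun i is _ => .triple (.var (by simpa using h₀)) (.var (by simp))
      (.var (by simpa using h₂))) fun i is _ => ?_).mono
    (Nat.le_of_eq (by rw [List.length_finRange]; ring))
  convert search_runsIn i (hc i) T l (searchResult h T l is) using 2
  simp only [searchResult, List.findSome?_cons]
  split <;> rename_i hfind <;> rw [hfind]
  exacts [Option.some_or.symm, Option.none_or.symm]

/-- The tuples of parameters that the learner tries. -/
def candidates (acc : A.Access) (R ℓ : ℕ) (T : List ((Fin k → V) × Bool)) : List (Fin ℓ → V) :=
  tuplesList ((expandList acc)^[R] (collectList T)) ℓ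

theorem mem_candidates {R : ℕ} {v : Fin ℓ → V} :
    v ∈ candidates acc R ℓ T ↔ ∀ j, v j ∈ A.ball R (trainingElems T) := by
  have htraining : {a | a ∈ collectList T} = trainingElems T := Set.ext fun _ => mem_collectList
  simp only [candidates, mem_tuplesList, mem_iterate_expandList, htraining]

/-- Tries all formulas with all parameters from the `R`-neighbourhood of the training elements. -/
def Prog.learner (k ℓ R : ℕ) (mc : Fin N → Prog σ W P) : Prog σ W P :=
  .seq (.call 1 collect (.triple .nil .nil (.var 0))) <|
  .seq (expandIter R) <| .seq (tuplesIter ℓ) <| .seq (searchAll k mc) <| .assign 0 (.var 3)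

theorem Prog.learner_runsIn [Finite V] {R K : ℕ}
    (hc : ∀ i v a, (mc i).DecidesIn acc (.tuple (Fin.append a v)) (h i v a) B)
    (hK : T.length * k * (A.degree + 1) ^ R ≤ K) :
    (learner k ℓ R mc).RunsIn acc (Val.training T)
      (Val.hypothesis (searchResult h T (candidates acc R ℓ T) (List.finRange N)))
      (28 + T.length * (36 + k * 21) +
        R * (18 + K * (40 + (A.degree + 1) * nameLen V + (A.degree + 1) * 21)) +
        ℓ * (18 + K * (36 + (K + 1) ^ ℓ * 24)) +
        N * (18 + (K + 1) ^ ℓ * (T.length * (B + k * (k + 6) + 27) + 2 * N + 50))) := by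
  set near := (expandList acc)^[R] (collectList T) with hnear
  have hcollect : (collectList T).length * (A.degree + 1) ^ R ≤ K :=
    (Nat.mul_le_mul_right _ (length_collectList_le T)).trans hK
  have hnear_le : near.length ≤ K := (length_iterate_expandList_le acc _ R).trans hcollect
  have htuples_le {j : ℕ} (hj : j ≤ ℓ) : (tuplesList near j).length ≤ (K + 1) ^ ℓ :=
    calc (tuplesList near j).length ≤ near.length ^ j := length_tuplesList_le near j
      _ ≤ (K + 1) ^ j := by gcongr; omega
      _ ≤ (K + 1) ^ ℓ := Nat.pow_le_pow_right K.succ_pos hj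
  refine (((ExecIn.call 1 (.triple .nil .nil (.var (initStore_zero _))) (collect_runsIn T)).seq <|
    (expandIter_execIn (by simp) hcollect).seq <|
    (tuplesIter_execIn (by simp [hnear]) hnear_le fun j hj => htuples_le hj.le).seq <|
    (searchAll_execIn (T := T) (l := tuplesList near ℓ) hc (by simp [initStore]) (by simp)).seq <|
    ExecIn.assign 0 (.var (Function.update_self _ _ _))).mono ?_).runsIn
    (Function.update_self _ _ _)
  have := Nat.mul_le_mul_left N (Nat.add_le_add_left (Nat.mul_le_mul_right
    (T.length * (B + k * (k + 6) + 27) + 2 * N + 50) (htuples_le le_rfl)) 18)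
  omega

end Learner

/-! ### Exact learning -/

section PolynomialTime

open Polynomial

/-- The time bound of `Prog.learner`, as a polynomial in the length of the training sequence, the
degree and the length of the names of elements, up to the factor for model checking. -/
noncomputable def learnerTime (k ℓ R N : ℕ) : ℕ[X] :=
  let x : ℕ[X] := X
  let near : ℕ[X] := k * x ^ (R + 1)
  let tuples : ℕ[X] := (near + 1) ^ ℓ
  28 + x * (36 + k * 21) + R * (18 + near * (40 + x * x + x * 21)) +
    ℓ * (18 + near * (36 + tuples * 24)) +
    N * (18 + tuples * (x * (k * (k + 6) + 28) + 2 * N + 50))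

theorem eval_le_eval_one_mul_pow (p : ℕ[X]) {m : ℕ} (hm : 1 ≤ m) :
    p.eval m ≤ p.eval 1 * m ^ p.natDegree := by
  rw [eval_eq_sum_range, eval_eq_sum_range, Finset.sum_mul]
  simp only [one_pow, mul_one]
  gcongr with i hi
  exact Finset.mem_range_succ_iff.1 hi

theorem Prog.learner_runsIn_learnerTime {S : WeightColl} {σ : Sig} {W : WSig S} {P : PredColl S}
    {V : Type} [Finite V] {A : WStr σ W V} {acc : A.Access} {B k ℓ N R m : ℕ}
    {mc : Fin N → Prog σ W P} {h : Fin N → (Fin ℓ → V) → (Fin k → V) → Bool}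
    {T : List ((Fin k → V) × Bool)} (hB : 0 < B)
    (hc : ∀ i v a, (mc i).DecidesIn acc (.tuple (Fin.append a v)) (h i v a) B)
    (hT : T.length ≤ m) (hdegree : A.degree + 1 ≤ m) (hname : nameLen V ≤ m) :
    (learner k ℓ R mc).RunsIn acc (Val.training T)
      (Val.hypothesis (searchResult h T (candidates acc R ℓ T) (List.finRange N)))
      (B * (learnerTime k ℓ R N).eval m) := by
  have hK : T.length * k * (A.degree + 1) ^ R ≤ k * m ^ (R + 1) :=
    calc T.length * k * (A.degree + 1) ^ R ≤ m * k * m ^ R := by gcongr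
      _ = k * m ^ (R + 1) := by ring
  have hmul (a : ℕ) : a ≤ B * a := Nat.le_mul_of_pos_left a hB
  have hcall : B + k * (k + 6) + 27 ≤ B * (k * (k + 6) + 28) :=
    calc B + k * (k + 6) + 27 ≤ B + B * (k * (k + 6)) + B * 27 := by
          gcongr B + ?_ + ?_ <;> exact hmul _
      _ = B * (k * (k + 6) + 28) := by ring
  have hsearch (M : ℕ) : N * (18 + M * (T.length * (B + k * (k + 6) + 27) + 2 * N + 50)) ≤
      B * (N * (18 + M * (m * (k * (k + 6) + 28) + 2 * N + 50))) :=
    calc _ ≤ N * (B * 18 + M * (m * (B * (k * (k + 6) + 28)) + B * (2 * N) + B * 50)) := by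
          gcongr N * (?_ + M * (?_ * ?_ + ?_ + ?_)) <;> exact hmul _
      _ = _ := by ring
  refine (learner_runsIn hc hK).mono ?_
  simp only [learnerTime, eval_add, eval_mul, eval_pow, eval_X, eval_natCast, eval_one,
    eval_ofNat, Nat.cast_id]
  rw [mul_add B]
  refine Nat.add_le_add ((hmul _).trans' ?_) (hsearch _)
  gcongr

end PolynomialTime

section ExactLearning

variable {S : WeightColl} {P : PredColl S} {W : WSig S} {σ σs : Sig} {L : WLogic.{u} σ W}
  {Ls : WLogic.{v} σs W} {k ℓ r N : ℕ} {V : Type} {T : List ((Fin k → V) × Bool)}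

theorem HasLocalNormalForms.isLocalFVClass {Φ : Set L.Formula} {Φs : Set Ls.Formula}
    (h : HasLocalNormalForms k ℓ r Φ Φs) : Ls.IsLocalFVClass (k + ℓ) r Φs :=
  ⟨h.free_subset_star, h.isLocal, h.fv, h.neg, h.or⟩

theorem trainingElems_nonempty (hk : 0 < k) (hT : T ≠ []) : (trainingElems T).Nonempty :=
  have ⟨p, hp⟩ := List.exists_mem_of_ne_nil T hT
  ⟨p.1 ⟨0, hk⟩, p, hp, _, rfl⟩

variable [Finite V] {A : WStr σ W V}

theorem IsAssociated.conceptClass_subset {Φ : Set L.Formula} {Φs : Set Ls.Formula}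
    {As : WStr σs W V} (h : IsAssociated k ℓ Φ Φs A As) :
    L.conceptClass Φ A k ℓ ⊆ Ls.conceptClass Φs As k ℓ := by
  rintro _ ⟨φ, hφ, v, rfl⟩
  obtain ⟨ψ, hψ, hiff⟩ := h.2 φ hφ
  exact ⟨ψ, hψ, v, funext fun a => decide_eq_decide.2 (hiff a v)⟩

theorem ModelChecksWithin.decidesIn {Φ : Fin N → L.Formula} {mc : Fin N → Prog σ W P} {f : ℕ}
    (hmc : ModelChecksWithin k ℓ Φ mc A f) (acc : A.Access) (i : Fin N) (v : Fin ℓ → V)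
    (a : Fin k → V) :
    (mc i).DecidesIn acc (.tuple (Fin.append a v)) (L.concept A (Φ i) v a) f := by
  obtain ⟨y, t, hrun, ht, hy⟩ := hmc acc i a v
  exact ⟨y, ⟨t, ht, hrun⟩, by simp [hy, WLogic.concept]⟩

theorem WLogic.IsLocalFVClass.exists_near_consistent {Φ : Set L.Formula}
    (hΦ : L.IsLocalFVClass (k + ℓ) r Φ) (hA : A.IsWeighted)
    (hT : ℓ = 0 ∨ (trainingElems T).Nonempty) {h : (Fin k → V) → Bool}
    (hh : h ∈ L.conceptClass Φ A k ℓ) (hcons : Consistent h T) :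
    ∃ ψ ∈ Φ, ∃ v : Fin ℓ → V, (∀ j, v j ∈ A.ball ((2 * r + 1) * ℓ) (trainingElems T)) ∧
      Consistent (L.concept A ψ v) T := by
  obtain ⟨φ, hφ, v, rfl⟩ := hh
  obtain ⟨ψ, hψ, v', hv', hiff⟩ := hΦ.exists_near_hypothesis hA hT hφ v
  refine ⟨ψ, hψ, v', hv', fun p hp => ?_⟩
  rw [← hcons p hp]
  exact decide_eq_decide.2 (hiff p.1 fun i => ⟨p, hp, i, rfl⟩).symm

theorem WLogic.IsLocalFVClass.not_consistent_of_searchResult_eq_none {Φ : Fin N → L.Formula}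
    (hΦ : L.IsLocalFVClass (k + ℓ) r (Set.range Φ)) (hA : A.IsWeighted)
    (hT : ℓ = 0 ∨ (trainingElems T).Nonempty) {acc : A.Access}
    (hnone : searchResult (fun i v => L.concept A (Φ i) v) T
      (candidates acc ((2 * r + 1) * ℓ) ℓ T) (List.finRange N) = none)
    {h : (Fin k → V) → Bool} (hh : h ∈ L.conceptClass (Set.range Φ) A k ℓ) :
    ¬ Consistent h T := by
  intro hcons
  obtain ⟨_, ⟨i, rfl⟩, v, hv, hcons'⟩ := hΦ.exists_near_consistent hA hT hh hcons
  exact searchResult_eq_none.1 hnone i (List.mem_finRange i) v (mem_candidates.2 hv) hcons'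

end ExactLearning

theorem mainTheorem9 {S : WeightColl} (P : PredColl S) (W : WSig S) (σ σs : Sig)
    (k ℓ r N : ℕ) (L : WLogic.{u} σ W) (Ls : WLogic.{v} σs W)
    (Φ : Set L.Formula) (Φs : Fin N → Ls.Formula)
    (hΦ : HasLocalNormalForms k ℓ r Φ (Set.range Φs)) :
    ∃ C c : ℕ, ∀ mc : Fin N → Prog σs W P, ∃ learner : Prog σs W P,
      ∀ (V : Type) [Finite V] [Nonempty V] (A : WStr σ W V) (As : WStr σs W V),
        A.IsWeighted → IsAssociated k ℓ Φ (Set.range Φs) A As →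
        ∀ f : ℕ, 0 < f → ModelChecksWithin k ℓ Φs mc As f →
        ∀ (acc : As.Access) (T : List ((Fin k → V) × Bool)),
          (ℓ = 0 ∨ (0 < k ∧ T ≠ [])) →
          ∃ (y : Val S V) (time : ℕ), learner.Runs acc (Val.training T) y time ∧
            time ≤ C * f * (Nat.log 2 (Nat.card V) + As.degree + T.length + 1) ^ c ∧
            ((∃ (i : Fin N) (v : Fin ℓ → V),
                y = .cons (Val.num i) (Val.tuple v) ∧
                Consistent (Ls.concept As (Φs i) v) T ∧
                ∀ j, v j ∈ As.ball ((2 * r + 1) * ℓ) (trainingElems T)) ∨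
              (y = .nil ∧ ∀ h ∈ L.conceptClass Φ A k ℓ, ¬ Consistent h T)) := by
  set R := (2 * r + 1) * ℓ
  set p := learnerTime k ℓ R N
  have hclass := hΦ.isLocalFVClass
  refine ⟨p.eval 1, p.natDegree, fun mc => ⟨.learner k ℓ R mc, ?_⟩⟩
  intro V _ _ A As _ hAs f hf hmc acc T hT
  have hX : ℓ = 0 ∨ (trainingElems T).Nonempty :=
    hT.imp_right fun ⟨hk, hne⟩ => trainingElems_nonempty hk hne
  set m := Nat.log 2 (Nat.card V) + As.degree + T.length + 1
  obtain ⟨time, htime, hrun⟩ := Prog.learner_runsIn_learnerTime (T := T) (R := R) (m := m) hf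
    (hmc.decidesIn acc) (by omega) (by omega) (by rw [nameLen]; omega)
  refine ⟨_, time, hrun, ?_, ?_⟩
  · calc time ≤ f * p.eval m := htime
      _ ≤ f * (p.eval 1 * m ^ p.natDegree) :=
        Nat.mul_le_mul_left f (eval_le_eval_one_mul_pow p (by omega))
      _ = p.eval 1 * f * m ^ p.natDegree := by ring
  cases hres : searchResult (fun i v => Ls.concept As (Φs i) v) T (candidates acc R ℓ T)
      (List.finRange N) with
  | some hypothesis =>
    obtain ⟨hv, hcons⟩ := mem_and_consistent_of_searchResult_eq_some hres
    exact Or.inl ⟨hypothesis.1, hypothesis.2, rfl, hcons, mem_candidates.1 hv⟩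
  | none =>
    exact Or.inr ⟨rfl, fun h hh => hclass.not_consistent_of_searchResult_eq_none hAs.1 hX hres
      (hAs.conceptClass_subset hh)⟩
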